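/- Let $K$ be a number field with ring of integers $\mathcal{O}_K$. For a prime (nonzero prime ideal) $\mathfrak{p}$ of $\mathcal{O}_K$ let $v_{\mathfrak p}\colon K\to\mathbb{Z}\cup\{\infty\}$ be the normalised additive $\mathfrak p$-adic valuation, and for a polynomial $g\in K[x]$ let $\Delta(g)$ denote its discriminant. Write $f^n$ for the $n$-th iterate of a polynomial $f$ under composition ($f^0=x$), $f^{-n}(x_0)=\{\alpha\in\overline{K} : f^n(\alpha)=x_0\}$, and $[S_d]^n$ for the $n$-fold iterated wreath product of the symmetric group $S_d$ acting on $d$ letters, that is, $[S_d]^0=1$ and $[S_d]^{n+1}=\big([S_d]^n\big)^d\rtimes S_d$ with $S_d$ permuting the $d$ factors. **Theorem 3.1.** Fix integers $d>m\geq 2$ with $\gcd(m,d)=1$ and $m>d/2$. Let $b,x_0\in K$ be such that $x_0=s/t$ and $b=u/w$ with $s,t,u,w\in\mathcal{O}_K$, $t,w\neq 0$, where $s\mathcal{O}_K+t\mathcal{O}_K=\mathcal{O}_K$ and $u\mathcal{O}_K+w\mathcal{O}_K=\mathcal{O}_K$. Suppose that the polynomial $f(x)=x^d-bx^m$ satisfies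 the following properties. 1. There is a prime $\mathfrak{p}_1$ of $\mathcal{O}_K$ with $v_{\mathfrak{p}_1}(b)\geq 1$ and $v_{\mathfrak{p}_1}(x_0)=1$. 2. There is a prime $\mathfrak{p}_2$ of $\mathcal{O}_K$ such that $\mathfrak{p}_2\nmid (d-m)$, $v_{\mathfrak{p}_2}(b)<\min\{v_{\mathfrak{p}_2}(x_0),0\}$, $(d-m)\mid v_{\mathfrak{p}_2}(b)$, and $\gcd\big(m,v_{\mathfrak{p}_2}(x_0/b)\big)=1$. 3. For each $n\geq 1$ there is a prime $\mathfrak{p}$ of $\mathcal{O}_K$ with $\mathfrak{p}\nmid stuwd(d-m)$ such that $v_{\mathfrak p}\big(\Delta(f^n(x)-x_0)\big)$ is positive and odd, and $v_{\mathfrak p}\big(\Delta(f^{\ell}(x)-x_0)\big)=0$ for all $0\leq \ell<n$. Then for all $n\geq 0$, $$\mathrm{Gal}\Big(K\big(f^{-n}(x_0)\big)/K\Big)\cong [S_d]^n .$$ -/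

import Mathlib

open Polynomial
open scoped NumberField

namespace Arboreal

/-- The additive `𝔭`-adic valuation `v_𝔭 : K → ℤ ∪ {∞}` of a number field `K` at a prime `𝔭`
of its ring of integers, normalised to have value group `ℤ` on `Kˣ`, with `v_𝔭(0) = ∞`.
Mathlib's multiplicative valuation is `exp (-v_𝔭(x))`. -/
noncomputable def ord {K : Type*} [Field K] [NumberField K]
    (p : IsDedekindDomain.HeightOneSpectrum (𝓞 K)) (x : K) : WithTop ℤ :=
  open Classical in
  if x = 0 then ⊤ else ((-WithZero.log (p.valuation K x) : ℤ) : WithTop ℤ)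

/-- The `n`-th iterate `f ∘ f ∘ ⋯ ∘ f` of a polynomial, with `f^0 = X`. -/
noncomputable def iter {K : Type*} [Field K] (f : K[X]) (n : ℕ) : K[X] :=
  f.comp^[n] X

/-- The set `f^{-n}(x₀)` of `n`-th preimages of `x₀` in the algebraic closure of `K`. -/
def preimages {K : Type*} [Field K] (f : K[X]) (x₀ : K) (n : ℕ) :
    Set (AlgebraicClosure K) :=
  {α | aeval α (iter f n) = algebraMap K (AlgebraicClosure K) x₀}

/-- The field `K(f^{-n}(x₀))`. -/
noncomputable def preimageField {K : Type*} [Field K] (f : K[X]) (x₀ : K) (n : ℕ) :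
    IntermediateField K (AlgebraicClosure K) :=
  IntermediateField.adjoin K (preimages f x₀ n)

/-- The `n`-fold wreath product `[S_d]^n` of the symmetric group `S_d` with itself, with respect
to its natural action on `d` letters: `[S_d]^0` is trivial and
`[S_d]^{n+1} = [S_d]^n ≀ S_d = ([S_d]^n)^d ⋊ S_d`, where `S_d` permutes the `d` factors. -/
def wreathSym (d : ℕ) : ℕ → GrpCat.{0}
  | 0 => GrpCat.of PUnit
  | n + 1 => GrpCat.of ((Fin d → wreathSym d n) ⋊[mulAutArrow] Equiv.Perm (Fin d))

end Arboreal

/-!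
The Galois group acts on the tree of iterated preimages of `x₀`. The iterates are Eisenstein at
`𝔭₁`, so the group is transitive on every level. At `𝔭₂`, following a branch of preimages of small
absolute value, each fibre of `f` splits into `m` small points and `d - m` large ones; the small
points are totally ramified, so inertia permutes them transitively, while it fixes the large ones.
At the prime `𝔭` of condition (3), the reduction of `f^n - x₀` has a single multiple root, which is
double, and since the discriminant has odd valuation, inertia acts on level `n` as the transposition
of the two points above it. These three facts, with `m > d / 2` and `gcd(m, d) = 1`, put every
transposition of two siblings in level `n` into the group, and by induction on `n` the group
consists of all automorphisms of the tree.
-/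

namespace Arboreal

section WreathProduct

open Equiv

/-- The group of permutations preserving each relation of a family; for the relations of having the
same ancestor at height `k` it is the automorphism group of a tree acting on its leaves. -/
def preservingPerms {ι X : Type*} (r : ι → X → X → Prop) : Subgroup (Perm X) where
  carrier := {τ | ∀ i x y, r i (τ x) (τ y) ↔ r i x y}
  mul_mem' hσ hτ i x y := (hσ i _ _).trans (hτ i x y)
  one_mem' _ _ _ := Iff.rfl
  inv_mem' {τ} hτ i x y := by simpa using (hτ i (τ⁻¹ x) (τ⁻¹ y)).symm

theorem mem_preservingPerms {ι X : Type*} {r : ι → X → X → Prop} {τ : Perm X} :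
    τ ∈ preservingPerms r ↔ ∀ i x y, r i (τ x) (τ y) ↔ r i x y :=
  Iff.rfl

theorem exists_perm_semiconj {X Y : Type*} {p : X → Y} (hp : Function.Surjective p) {τ : Perm X}
    (hτ : ∀ x y, p (τ x) = p (τ y) ↔ p x = p y) : ∃ σ : Perm Y, ∀ x, σ (p x) = p (τ x) := by
  have hσ : Function.Bijective fun y => p (τ (Function.surjInv hp y)) := by
    refine ⟨fun y y' h => ?_, fun y => ⟨p (τ.symm (Function.surjInv hp y)), ?_⟩⟩
    · simpa only [Function.surjInv_eq] using (hτ _ _).1 h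
    · change p (τ _) = y
      rw [(hτ _ _).2 (Function.surjInv_eq hp _), apply_symm_apply, Function.surjInv_eq hp]
  exact ⟨ofBijective _ hσ, fun x => (hτ _ _).2 (Function.surjInv_eq hp _)⟩

theorem map_preservingPerms {ι κ X Y : Type*} (ε : ι ≃ κ) (e : X ≃ Y) {r : ι → X → X → Prop}
    {s : κ → Y → Y → Prop} (hrs : ∀ i x y, s (ε i) (e x) (e y) ↔ r i x y) :
    (preservingPerms r).map e.permCongrHom.toMonoidHom = preservingPerms s := by
  ext τ
  obtain ⟨τ, rfl⟩ := e.permCongrHom.surjective τ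
  rw [Subgroup.mem_map_equiv, MulEquiv.symm_apply_apply]
  simp only [mem_preservingPerms, ε.surjective.forall, e.surjective.forall, permCongrHom_coe,
    permCongr_apply, symm_apply_apply, hrs]

variable {A W Z : Type*} [Group W]

/-- The imprimitive action of the wreath product `W ≀ Perm A` on `A × Z`, for an action of `W`
on `Z`. -/
def wreathPerm (ρ : W →* Perm Z) : (A → W) ⋊[mulAutArrow] Perm A →* Perm (A × Z) where
  toFun g := prodShear g.right fun a => ρ (g.left (g.right a))
  map_one' := by ext x <;> simp
  map_mul' g h := by
    ext ⟨a, z⟩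
    · rfl
    · change ρ (g.left _ * h.left (g.right⁻¹ (g.right (h.right a)))) z = _
      simp

theorem wreathPerm_apply (ρ : W →* Perm Z) (g : (A → W) ⋊[mulAutArrow] Perm A) (a : A) (z : Z) :
    wreathPerm ρ g (a, z) = (g.right a, ρ (g.left (g.right a)) z) :=
  rfl

theorem wreathPerm_injective [Nonempty Z] {ρ : W →* Perm Z} (hρ : Function.Injective ρ) :
    Function.Injective (wreathPerm (A := A) ρ) := by
  refine (injective_iff_map_eq_one _).2 fun g hg => ?_
  have hfix (a : A) (z : Z) : (g.right a, ρ (g.left (g.right a)) z) = (a, z) := by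
    rw [← wreathPerm_apply, hg, Perm.one_apply]
  have hright : g.right = 1 :=
    Perm.ext fun a => congrArg Prod.fst (hfix a (Classical.arbitrary Z))
  refine SemidirectProduct.ext (funext fun a => hρ (Perm.ext fun z => ?_)) hright
  simpa [hright] using congrArg Prod.snd (hfix a z)

theorem exists_eq_prodShear [Nonempty Z] {τ : Perm (A × Z)}
    (hτ : ∀ x y, (τ x).1 = (τ y).1 ↔ x.1 = y.1) :
    ∃ (π : Perm A) (σ : A → Perm Z), τ = prodShear π σ := by
  obtain ⟨π, hπ⟩ := exists_perm_semiconj Prod.fst_surjective hτ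
  have hσ (a : A) : Function.Bijective fun z => (τ (a, z)).2 := by
    refine ⟨fun z z' h => ?_, fun z => ?_⟩
    · exact congrArg Prod.snd (τ.injective (Prod.ext ((hτ (a, z) (a, z')).2 rfl) h))
    · obtain ⟨⟨a', z'⟩, h⟩ := τ.surjective (π a, z)
      obtain rfl : a' = a := π.injective ((hπ _).trans (congrArg Prod.fst h))
      exact ⟨z', congrArg Prod.snd h⟩
  exact ⟨π, fun a => ofBijective _ (hσ a), Perm.ext fun ⟨a, z⟩ => Prod.ext (hπ (a, z)).symm rfl⟩

theorem range_wreathPerm [Nonempty Z] {ρ : W →* Perm Z} {ι : Type*} {r : ι → Z → Z → Prop}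
    (hρ : ρ.range = preservingPerms r) :
    (wreathPerm (A := A) ρ).range =
      preservingPerms fun (i : Option ι) x y => x.1 = y.1 ∧ ∀ j ∈ i, r j x.2 y.2 := by
  refine le_antisymm ?_ fun τ hτ => ?_
  · rintro _ ⟨g, rfl⟩ i ⟨a, z⟩ ⟨a', z'⟩
    simp only [wreathPerm_apply, g.right.injective.eq_iff]
    refine and_congr_right ?_
    rintro rfl
    have hmem : ρ (g.left (g.right a)) ∈ preservingPerms r := hρ.le ⟨_, rfl⟩
    exact forall₂_congr fun j _ => hmem j z z'
  obtain ⟨π, σ, rfl⟩ := exists_eq_prodShear fun x y => by simpa using hτ none x y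
  have hσ (a : A) : σ a ∈ ρ.range :=
    hρ.ge fun j z z' => by simpa using hτ (some j) (a, z) (a, z')
  choose w hw using hσ
  refine ⟨⟨fun a => w (π.symm a), π⟩, Perm.ext fun ⟨a, z⟩ => ?_⟩
  simp [wreathPerm_apply, hw]

theorem exists_wreathSym_action (d n : ℕ) [NeZero d] :
    ∃ ρ : wreathSym d n →* Perm (Fin n → Fin d), Function.Injective ρ ∧
      ρ.range = preservingPerms fun (k : Fin n) w w' => ∀ i ≥ k, w i = w' i := by
  induction n with
  | zero =>
    exact ⟨1, fun _ _ _ => rfl, le_antisymm (fun _ _ _ _ _ => by simp)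
      fun τ _ => ⟨1, Subsingleton.elim _ _⟩⟩
  | succ n ih =>
    obtain ⟨ρ, hinj, hrange⟩ := ih
    let e : Fin d × (Fin n → Fin d) ≃ (Fin (n + 1) → Fin d) := Fin.snocEquiv fun _ => Fin d
    let φ : (Fin d → wreathSym d n) ⋊[mulAutArrow] Perm (Fin d) →* Perm (Fin (n + 1) → Fin d) :=
      e.permCongrHom.toMonoidHom.comp (wreathPerm ρ)
    have hlast (x y) : (∀ i ≥ Fin.last n, e x i = e y i) ↔ x.1 = y.1 := by
      simp [e, Fin.last_le_iff]
    have hcastSucc (k : Fin n) (x y) :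
        (∀ i ≥ k.castSucc, e x i = e y i) ↔ x.1 = y.1 ∧ ∀ i ≥ k, x.2 i = y.2 i := by
      simp [e, Fin.forall_fin_succ', Fin.le_last, and_comm]
    have hφ : φ.range = preservingPerms fun (k : Fin (n + 1)) w w' => ∀ i ≥ k, w i = w' i := by
      rw [MonoidHom.range_comp, range_wreathPerm hrange]
      refine map_preservingPerms finSuccEquivLast.symm e fun k x y => ?_
      cases k with
      | none => simpa using hlast x y
      | some k => simpa using hcastSucc k x y
    exact ⟨φ, e.permCongrHom.injective.comp (wreathPerm_injective hinj), hφ⟩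

end WreathProduct

section Counting

variable {X Y : Type*} {p : X → Y} {S : Set X} {T : Set Y} {d : ℕ}

theorem encard_le_mul_of_mapsTo (hT : T.Finite) (hp : Set.MapsTo p S T)
    (hfib : ∀ y ∈ T, (S ∩ p ⁻¹' {y}).encard ≤ d) : S.encard ≤ d * T.encard := by
  lift T to Finset Y using hT
  calc S.encard ≤ (⋃ y ∈ T, S ∩ p ⁻¹' {y}).encard :=
        Set.encard_le_encard fun x hx => by simpa using And.intro hx (hp hx)
    _ ≤ ∑ y ∈ T, (S ∩ p ⁻¹' {y}).encard := T.set_encard_biUnion_le _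
    _ ≤ d * (T : Set Y).encard := by
        simpa [mul_comm] using Finset.sum_le_card_nsmul T _ (d : ℕ∞) hfib

theorem encard_fiber_eq_of_encard_eq_mul (hT : T.Finite) (hp : Set.MapsTo p S T)
    (hfib : ∀ y ∈ T, (S ∩ p ⁻¹' {y}).encard ≤ d) (hS : S.encard = d * T.encard) {y : Y}
    (hy : y ∈ T) : (S ∩ p ⁻¹' {y}).encard = d := by
  refine (hfib y hy).antisymm (not_lt.1 fun hlt => ?_)
  have hdiff : (S \ p ⁻¹' {y}).encard ≤ d * (T \ {y}).encard := by
    refine encard_le_mul_of_mapsTo hT.sdiff (fun x hx => ⟨hp hx.1, hx.2⟩) fun z hz => ?_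
    exact (Set.encard_le_encard (Set.inter_subset_inter_left _ Set.sdiff_subset)).trans
      (hfib z hz.1)
  have hfin : (S \ p ⁻¹' {y}).encard ≠ ⊤ :=
    (hdiff.trans_lt (WithTop.mul_lt_top (ENat.natCast_lt_top d) hT.sdiff.encard_lt_top)).ne
  have hlt' : S.encard < d * T.encard := by
    rw [← Set.encard_sdiff_add_encard_inter S (p ⁻¹' {y}), ← Set.encard_sdiff_singleton_add_one hy,
      mul_add_one]
    exact WithTop.add_lt_add_of_le_of_lt hfin hdiff hlt
  exact hlt'.ne hS

theorem exists_injective_range_eq_of_encard_eq {N : ℕ} (hS : S.encard = N) :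
    ∃ x : Fin N → X, Function.Injective x ∧ Set.range x = S := by
  have hfin := Set.finite_of_encard_eq_coe hS
  have : Finite S := hfin
  let e := (Finite.equivFinOfCardEq (Nat.cast_inj.1 (hfin.cast_ncard_eq.trans hS))).symm
  refine ⟨fun i => e i, Subtype.val_injective.comp e.injective, ?_⟩
  exact (e.surjective.range_comp Subtype.val).trans Subtype.range_coe

end Counting

section Tower

open Equiv

variable {G X : Type*} [Group G] [MulAction G X] {F : X → X} {c : X} {d n : ℕ}

theorem mem_of_forall_swap_mem {Y : Type*} [Finite X] [DecidableEq X] {H : Subgroup (Perm X)}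
    {p : X → Y} (hH : ∀ x y, p x = p y → swap x y ∈ H) {τ : Perm X} (hτ : ∀ x, p (τ x) = p x) :
    τ ∈ H := by
  let S : Set (Perm X) := {σ | σ.IsSwap ∧ σ ∈ H}
  suffices τ ∈ Subgroup.closure S from (Subgroup.closure_le H).2 (fun σ hσ => hσ.2) this
  refine (mem_closure_isSwap fun σ hσ => hσ.1).2 ⟨Set.toFinite _, fun x => ?_⟩
  rcases eq_or_ne x (τ x) with hx | hx
  · rw [← hx]
    exact MulAction.mem_orbit_self x
  · have hmem : swap x (τ x) ∈ S := ⟨⟨x, τ x, hx, rfl⟩, hH _ _ (hτ x).symm⟩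
    exact ⟨⟨_, Subgroup.subset_closure hmem⟩, swap_apply_left _ _⟩

theorem iterate_smul (hF : ∀ (g : G) x, F (g • x) = g • F x) (n : ℕ) (g : G) (x : X) :
    F^[n] (g • x) = g • F^[n] x :=
  (Function.Commute.iterate_left (f := F) (hF g) n) x

/-- The points that `F` sends to `c` after exactly `n` steps: level `n` of the tree of preimages of
`c`. -/
def level (F : X → X) (c : X) (n : ℕ) : Set X := F^[n] ⁻¹' {c}

theorem mem_level {x : X} : x ∈ level F c n ↔ F^[n] x = c :=
  Iff.rfl

theorem mapsTo_level : Set.MapsTo F (level F c (n + 1)) (level F c n) :=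
  fun _ hx => hx

theorem subsingleton_level_zero : Subsingleton (level F c 0) :=
  Set.subsingleton_singleton.coe_sort

theorem smul_mem_level_iff (hF : ∀ (g : G) x, F (g • x) = g • F x) (hc : ∀ g : G, g • c = c)
    (g : G) {x : X} : g • x ∈ level F c n ↔ x ∈ level F c n := by
  rw [mem_level, mem_level, iterate_smul hF, smul_eq_iff_eq_inv_smul, hc]

/-- The action on a level of the tree of preimages of `c`, for a group that commutes with `F` and
fixes `c`. -/
def levelPerm (hF : ∀ (g : G) x, F (g • x) = g • F x) (hc : ∀ g : G, g • c = c) (n : ℕ) :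
    G →* Perm (level F c n) where
  toFun g := (MulAction.toPerm g).subtypePerm fun _ => smul_mem_level_iff hF hc g
  map_one' := Perm.ext fun x => Subtype.ext (one_smul G (x : X))
  map_mul' g h := Perm.ext fun x => Subtype.ext (mul_smul g h (x : X))

theorem encard_level_le (hfib : ∀ y, (F ⁻¹' {y}).encard ≤ d) (c : X) (n : ℕ) :
    (level F c n).encard ≤ (d ^ n : ℕ) := by
  induction n with
  | zero => simp [level]
  | succ n ih =>
    calc (level F c (n + 1)).encard
        ≤ d * (level F c n).encard :=
          encard_le_mul_of_mapsTo (Set.finite_of_encard_le_coe ih) mapsTo_level fun y _ =>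
            (Set.encard_le_encard Set.inter_subset_right).trans (hfib y)
      _ ≤ d * (d ^ n : ℕ) := by gcongr
      _ = (d ^ (n + 1) : ℕ) := by rw [pow_succ', Nat.cast_mul]

theorem finite_level (hfib : ∀ y, (F ⁻¹' {y}).encard ≤ d) (c : X) (n : ℕ) :
    (level F c n).Finite :=
  Set.finite_of_encard_le_coe (encard_level_le hfib c n)

theorem encard_fiber_of_encard_level (hfib : ∀ y, (F ⁻¹' {y}).encard ≤ d)
    (hn : (level F c n).encard = (d ^ n : ℕ))
    (hn' : (level F c (n + 1)).encard = (d ^ (n + 1) : ℕ)) {y : X} (hy : y ∈ level F c n) :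
    (F ⁻¹' {y}).encard = d := by
  have hsub : F ⁻¹' {y} ⊆ level F c (n + 1) := by
    rintro x rfl
    exact hy
  rw [← Set.inter_eq_right.2 hsub]
  refine encard_fiber_eq_of_encard_eq_mul (finite_level hfib c n) mapsTo_level (fun y _ =>
    (Set.encard_le_encard Set.inter_subset_right).trans (hfib y)) ?_ hy
  rw [hn, hn', pow_succ', Nat.cast_mul]

theorem range_levelPerm [DecidableEq X] (hF : ∀ (g : G) x, F (g • x) = g • F x)
    (hc : ∀ g : G, g • c = c) {n : ℕ} (hfin : ∀ i ≤ n, (level F c i).Finite)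
    (hsurj : ∀ i < n, ∀ y ∈ level F c i, ∃ x, F x = y)
    (hswap : ∀ i < n, ∀ x y : level F c (i + 1), F x = F y →
      swap x y ∈ (levelPerm hF hc (i + 1)).range) :
    (levelPerm hF hc n).range =
      preservingPerms fun (k : Fin n) (x y : level F c n) => F^[k] x = F^[k] y := by
  induction n with
  | zero =>
    have := subsingleton_level_zero (F := F) (c := c)
    exact Subsingleton.elim _ _
  | succ n ih =>
    refine le_antisymm ?_ fun τ hτ => ?_
    · rintro _ ⟨g, rfl⟩ k x y
      change F^[k] (g • (x : X)) = F^[k] (g • (y : X)) ↔ _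
      rw [iterate_smul hF, iterate_smul hF, smul_left_cancel_iff]
    let p : level F c (n + 1) → level F c n := fun x => ⟨F x, x.2⟩
    have hp : Function.Surjective p := fun ⟨y, hy⟩ => by
      obtain ⟨x, rfl⟩ := hsurj n n.lt_succ_self y hy
      exact ⟨⟨x, hy⟩, rfl⟩
    have hpτ (x y) : p (τ x) = p (τ y) ↔ p x = p y := by
      cases n with
      | zero =>
        have := subsingleton_level_zero (F := F) (c := c)
        exact iff_of_true (Subsingleton.elim _ _) (Subsingleton.elim _ _)
      | succ n => simpa [p, Subtype.ext_iff] using hτ 1 x y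
    obtain ⟨σ, hσ⟩ := exists_perm_semiconj hp hpτ
    have hσmem : σ ∈ (levelPerm hF hc n).range := by
      rw [ih (fun i hi => hfin i (by lia)) (fun i hi => hsurj i (by lia))
        (fun i hi => hswap i (by lia))]
      intro k y y'
      obtain ⟨x, rfl⟩ := hp y
      obtain ⟨x', rfl⟩ := hp y'
      rw [hσ, hσ]
      exact hτ k.succ x x'
    obtain ⟨g, rfl⟩ := hσmem
    have hmem : (levelPerm hF hc (n + 1) g)⁻¹ * τ ∈ (levelPerm hF hc (n + 1)).range := by
      have := (hfin (n + 1) le_rfl).to_subtype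
      refine mem_of_forall_swap_mem (hswap n n.lt_succ_self) fun x => ?_
      rw [← map_inv]
      change F (g⁻¹ • (τ x : X)) = F x
      rw [hF, inv_smul_eq_iff]
      exact (congrArg Subtype.val (hσ x)).symm
    exact (Subgroup.mul_mem_cancel_left _ (inv_mem (MonoidHom.mem_range.2 ⟨g, rfl⟩))).1 hmem

theorem exists_label [NeZero d] (hfib : ∀ y, (F ⁻¹' {y}).encard ≤ d) :
    ∃ label : X → Fin d, ∀ x y, F x = F y → label x = label y → x = y := by
  have hinj (y : X) : ∃ g : X → Fin d, Set.InjOn g (F ⁻¹' {y}) := by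
    obtain ⟨g, -, hg⟩ := (Set.finite_of_encard_le_coe (hfib y)).exists_injOn_of_encard_le
      (t := (Set.univ : Set (Fin d))) (by simpa using hfib y)
    exact ⟨g, hg⟩
  choose g hg using hinj
  exact ⟨fun x => g (F x) x, fun x y hxy h => hg (F y) hxy rfl (by simpa [hxy] using h)⟩

theorem iterate_eq_iterate_iff_forall_label {A : Type*} {label : X → A}
    (hlabel : ∀ x y, F x = F y → label x = label y → x = y) {x y : X} (hxy : F^[n] x = F^[n] y)
    {k : ℕ} (hk : k ≤ n) :
    F^[k] x = F^[k] y ↔ ∀ i, k ≤ i → i < n → label (F^[i] x) = label (F^[i] y) := by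
  refine ⟨fun h i hki _ => ?_, fun h => ?_⟩
  · obtain ⟨j, rfl⟩ := Nat.exists_eq_add_of_le' hki
    rw [Function.iterate_add_apply, h, ← Function.iterate_add_apply]
  · induction hk using Nat.decreasingInduction with
    | self => exact hxy
    | of_succ k hk ih =>
      refine hlabel _ _ ?_ (h k le_rfl hk)
      simpa only [← Function.iterate_succ_apply'] using ih fun i hi => h i (by lia)

theorem nonempty_mulEquiv_wreathSym [NeZero d] [DecidableEq X]
    (hF : ∀ (g : G) x, F (g • x) = g • F x) (hc : ∀ g : G, g • c = c)
    (hfib : ∀ y, (F ⁻¹' {y}).encard ≤ d) (hcard : ∀ i ≤ n, (level F c i).encard = (d ^ i : ℕ))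
    (hswap : ∀ i < n, ∀ x y : level F c (i + 1), F x = F y →
      swap x y ∈ (levelPerm hF hc (i + 1)).range)
    (hfaithful : Function.Injective (levelPerm hF hc n)) :
    Nonempty (G ≃* wreathSym d n) := by
  obtain ⟨label, hlabel⟩ := exists_label hfib
  have := (finite_level hfib c n).to_subtype
  have hrange := range_levelPerm hF hc (fun i _ => finite_level hfib c i) (fun i hi y hy => by
    have hfiber := encard_fiber_of_encard_level hfib (hcard i hi.le) (hcard (i + 1) hi) hy
    exact Set.encard_ne_zero.1 (hfiber.trans_ne (Nat.cast_ne_zero.2 (NeZero.ne d)))) hswap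
  let code (x : level F c n) (i : Fin n) : Fin d := label (F^[i] x)
  have hcode (k : Fin n) (x y : level F c n) :
      (∀ i ≥ k, code x i = code y i) ↔ F^[k] x = F^[k] y := by
    rw [iterate_eq_iterate_iff_forall_label hlabel (x.2.trans y.2.symm) k.2.le, Fin.forall_iff]
    exact ⟨fun h i hki hi => h i hi hki, fun h i hi hki => h i hki hi⟩
  have hinj : Function.Injective code := fun x y hxy => Subtype.ext
    ((iterate_eq_iterate_iff_forall_label hlabel (x.2.trans y.2.symm) n.zero_le).2
      fun i _ hi => congrFun hxy ⟨i, hi⟩)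
  have hcardeq : Nat.card (level F c n) = Nat.card (Fin n → Fin d) := by
    rw [Nat.card_coe_set_eq, Set.ncard, hcard n le_rfl]
    simp
  let e : level F c n ≃ (Fin n → Fin d) :=
    ofBijective code (Nat.bijective_iff_injective_and_card _ |>.2 ⟨hinj, hcardeq⟩)
  obtain ⟨ρ, hρinj, hρ⟩ := exists_wreathSym_action d n
  let ψ : G →* Perm (Fin n → Fin d) := e.permCongrHom.toMonoidHom.comp (levelPerm hF hc n)
  have hψ : ψ.range = ρ.range := by
    rw [MonoidHom.range_comp, hrange, hρ]
    exact map_preservingPerms (Equiv.refl _) e hcode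
  have hψinj : Function.Injective ψ := e.permCongrHom.injective.comp hfaithful
  exact ⟨(MonoidHom.ofInjective hψinj).trans
    ((MulEquiv.subgroupCongr hψ).trans (MonoidHom.ofInjective hρinj).symm)⟩

end Tower

section Transpositions

open Equiv

theorem dvd_ncard_of_saturated {X : Type*} (s : Setoid X) {k : ℕ} (hk : ∀ x, {y | s x y}.ncard = k)
    {T : Set X} (hfin : T.Finite) (hT : ∀ x ∈ T, ∀ y, s x y → y ∈ T) : k ∣ T.ncard := by
  classical
  lift T to Finset X using hfin
  rw [Set.ncard_coe_finset, Finset.card_eq_sum_card_image (Quotient.mk s)]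
  refine Finset.dvd_sum fun C hC => ?_
  obtain ⟨x, hx, rfl⟩ := Finset.mem_image.1 hC
  rw [← hk x, ← Set.ncard_coe_finset]
  refine dvd_of_eq (congrArg Set.ncard (Set.ext fun y => ?_))
  simp only [Set.mem_ofPred_eq, Finset.coe_filter, Quotient.eq]
  exact ⟨fun h => ⟨hT x hx y h, s.symm h⟩, fun h => s.symm h.2⟩

variable {X Y : Type*} [DecidableEq X] {H : Subgroup (Perm X)} {F : X → Y} {d m : ℕ} {x y : X}

/-- Two points are equivalent when a group of permutations contains the transposition exchanging
them. -/
def swapSetoid (H : Subgroup (Perm X)) : Setoid X where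
  r x y := swap x y ∈ H
  iseqv :=
    { refl := fun x => (swap_self x).symm ▸ H.one_mem
      symm := fun {x y} h => by rwa [swap_comm]
      trans := SubmonoidClass.swap_mem_trans H }

theorem swapSetoid_apply_iff {h : Perm X} (hh : h ∈ H) :
    swapSetoid H (h x) (h y) ↔ swapSetoid H x y := by
  change swap (h x) (h y) ∈ H ↔ swap x y ∈ H
  rw [swap_apply_apply, H.mul_mem_cancel_right (H.inv_mem hh), H.mul_mem_cancel_left hh]

theorem ncard_swapSetoid_eq (htrans : ∀ x y, ∃ h ∈ H, h x = y) (x y : X) :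
    {z | swapSetoid H x z}.ncard = {z | swapSetoid H y z}.ncard := by
  obtain ⟨h, hh, rfl⟩ := htrans x y
  rw [← Set.ncard_image_of_injective _ h.injective]
  congr 1
  ext z
  obtain ⟨z, rfl⟩ := h.surjective z
  rw [h.injective.mem_set_image, Set.mem_ofPred_eq, Set.mem_ofPred_eq, swapSetoid_apply_iff hh]

theorem map_eq_of_swap_mem (hF : ∀ h ∈ H, ∀ x y, F x = F y → F (h x) = F (h y))
    (hfib : 1 < (F ⁻¹' {F x}).ncard) (hxy : swap x y ∈ H) : F x = F y := by
  obtain ⟨z, hz, hzx⟩ := Set.exists_ne_of_one_lt_ncard hfib x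
  rcases eq_or_ne z y with rfl | hzy
  · exact hz.symm
  · have hswap := hF _ hxy z x hz
    rw [swap_apply_left, swap_apply_of_ne_of_ne hzx hzy] at hswap
    exact hz.symm.trans hswap

/-- The classes of `swapSetoid H` lie in the fibres of `F` and have a common size `k` dividing `d`.
If `S` is a union of classes, then `k` divides `gcd m d = 1`; otherwise a class contains `S` and
a further point, so `k > m > d / 2` and the classes are the fibres. -/
theorem swap_mem_of_fiber [Finite X] (hcop : m.Coprime d) (hmd : m < d) (hdm : d < 2 * m)
    (htrans : ∀ x y, ∃ h ∈ H, h x = y) (hF : ∀ h ∈ H, ∀ x y, F x = F y → F (h x) = F (h y))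
    (hfib : ∀ x, (F ⁻¹' {F x}).ncard = d) (hswap : ∃ x y, x ≠ y ∧ swap x y ∈ H) {α : Y}
    {S : Set X} (hS : S ⊆ F ⁻¹' {α}) (hSm : S.ncard = m)
    (hStrans : ∀ s ∈ S, ∀ s' ∈ S, ∃ h ∈ H, h s = s' ∧ ∀ t, F t = α → t ∉ S → h t = t)
    (hxy : F x = F y) : swap x y ∈ H := by
  obtain ⟨a, b, hab, hswap⟩ := hswap
  obtain ⟨k, hk⟩ : ∃ k, ∀ x, {y | swapSetoid H x y}.ncard = k :=
    ⟨_, fun x => ncard_swapSetoid_eq htrans x a⟩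
  have hsub (x : X) : {y | swapSetoid H x y} ⊆ F ⁻¹' {F x} := fun y hy =>
    (map_eq_of_swap_mem hF (by rw [hfib]; lia) hy).symm
  have hk1 : 1 < k := by
    rw [← hk a, Set.one_lt_ncard_iff]
    exact ⟨a, b, (swapSetoid H).refl a, hswap, hab⟩
  have hkd : k ∣ d := by
    rw [← hfib a]
    exact dvd_ncard_of_saturated _ hk (Set.toFinite _) fun x hx y hxy => (hsub x hxy).trans hx
  by_cases hsat : ∀ s ∈ S, ∀ y, swapSetoid H s y → y ∈ S
  · have hkm : k ∣ m := hSm ▸ dvd_ncard_of_saturated _ hk S.toFinite hsat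
    exact absurd (Nat.eq_one_of_dvd_coprimes hcop hkm hkd) hk1.ne'
  · push Not at hsat
    obtain ⟨s, hs, γ, hsγ, hγ⟩ := hsat
    have hclass : insert γ S ⊆ {t | swapSetoid H γ t} := by
      refine Set.insert_subset ((swapSetoid H).refl γ) fun t ht => ?_
      obtain ⟨h, hh, rfl, hfix⟩ := hStrans s hs t ht
      refine (swapSetoid H).symm ?_
      change swapSetoid H (h s) γ
      rwa [← hfix γ ((hsub s hsγ).trans (hS hs)) hγ, swapSetoid_apply_iff hh]
    have hmk : m + 1 ≤ k := by
      rw [← hSm, ← hk γ, ← Set.ncard_insert_of_notMem hγ]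
      exact Set.ncard_le_ncard hclass
    have hkeq : k = d := by
      obtain ⟨q, rfl⟩ := hkd
      have hq : q < 2 := by nlinarith
      interval_cases q <;> lia
    have hfull := Set.eq_of_subset_of_ncard_le (hsub x) (by rw [hfib, hk, hkeq])
    exact hfull.ge hxy.symm

end Transpositions

section SiblingSwap

open Equiv

variable {G X : Type*} [Group G] [MulAction G X] [DecidableEq X] {F : X → X} {c : X} {d m n : ℕ}

theorem ncard_preimage_val_of_subset {Y : Type*} {S T : Set Y} (h : S ⊆ T) :
    ((↑) ⁻¹' S : Set T).ncard = S.ncard := by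
  rw [← Set.ncard_image_of_injective _ Subtype.val_injective, Subtype.image_preimage_coe,
    Set.inter_eq_right.2 h]

theorem swap_mem_range_levelPerm (hF : ∀ (g : G) x, F (g • x) = g • F x) (hc : ∀ g : G, g • c = c)
    (hmd : m < d) (hdm : d < 2 * m) (hcop : m.Coprime d) (hfin : (level F c (n + 1)).Finite)
    (hfib : ∀ y ∈ level F c n, (F ⁻¹' {y}).encard = d)
    (htrans : ∀ x ∈ level F c (n + 1), ∀ x' ∈ level F c (n + 1), ∃ g : G, g • x = x')
    (hpart : ∃ α ∈ level F c n, ∃ S ⊆ F ⁻¹' {α}, S.encard = m ∧ ∀ s ∈ S, ∀ s' ∈ S,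
      ∃ g : G, g • s = s' ∧ ∀ t, F t = α → t ∉ S → g • t = t)
    (hswap : ∃ g : G, ∃ x ∈ level F c (n + 1), ∃ x' ∈ level F c (n + 1), x ≠ x' ∧
      ∀ t ∈ level F c (n + 1), g • t = swap x x' t)
    {x x' : level F c (n + 1)} (hxx' : F x = F x') :
    swap x x' ∈ (levelPerm hF hc (n + 1)).range := by
  have := hfin.to_subtype
  have hsub {y} (hy : y ∈ level F c n) : F ⁻¹' {y} ⊆ level F c (n + 1) := by
    rintro z rfl
    exact hy
  obtain ⟨α, hα, S, hS, hSm, hStrans⟩ := hpart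
  obtain ⟨g, z, hz, z', hz', hne, hg⟩ := hswap
  refine swap_mem_of_fiber (F := fun t : level F c (n + 1) => F t) (α := α) (S := Subtype.val ⁻¹' S)
    hcop hmd hdm ?_ ?_ (fun t => ?_) ?_ (fun t ht => @hS t ht) ?_ ?_ hxx'
  · intro t t'
    obtain ⟨h, hh⟩ := htrans t t.2 t' t'.2
    exact ⟨_, ⟨h, rfl⟩, Subtype.ext hh⟩
  · rintro _ ⟨h, rfl⟩ t t' htt'
    change F (h • (t : X)) = F (h • (t' : X))
    rw [hF, hF, htt']
  · have hFt : F t ∈ level F c n := mapsTo_level t.2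
    refine (ncard_preimage_val_of_subset (hsub hFt)).trans ?_
    rw [Set.ncard, hfib _ hFt, ENat.toNat_natCast]
  · refine ⟨⟨z, hz⟩, ⟨z', hz'⟩, fun h => hne (congrArg Subtype.val h), g, Perm.ext fun t => ?_⟩
    refine Subtype.ext ((hg t t.2).trans ?_)
    exact (Subtype.val_injective.swap_apply ⟨z, hz⟩ ⟨z', hz'⟩ t)
  · rw [ncard_preimage_val_of_subset (hS.trans (hsub hα)), Set.ncard, hSm, ENat.toNat_natCast]
  · intro s hs s' hs'
    obtain ⟨h, hh, hfix⟩ := hStrans s hs s' hs'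
    exact ⟨_, ⟨h, rfl⟩, Subtype.ext hh, fun t ht htS => Subtype.ext (hfix t ht htS)⟩

end SiblingSwap

section Inertia

open IsDedekindDomain WithZero

/-- A valuation `v` on `L` lying over a valuation `w` on `K`, with ramification index `e` and
inertia group `inertia`: `v` is unramified over `w` on the field fixed by inertia. -/
structure InertialExtension {K : Type*} [Field K] (w : Valuation K ℤᵐ⁰) (L : Type*) [Field L]
    [Algebra K L] where
  v : Valuation L ℤᵐ⁰
  e : ℕ
  inertia : Subgroup Gal(L/K)
  e_ne_zero : e ≠ 0
  valuation_algebraMap (x : K) : v (algebraMap K L x) = w x ^ e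
  exists_eq_pow_of_fixed (x : L) : (∀ σ ∈ inertia, σ x = x) → ∃ z : ℤᵐ⁰, v x = z ^ e
  valuation_sub_lt_one {σ : Gal(L/K)} (hσ : σ ∈ inertia) {x : L} : v x ≤ 1 → v (σ x - x) < 1

section NumberField

variable {K L : Type*} [Field K] [Field L] [NumberField L] [Algebra K L]

theorem valuation_apply_sub_lt_one (Q : HeightOneSpectrum (𝓞 L)) {σ : Gal(L/K)}
    (hσ : σ ∈ Q.asIdeal.inertia Gal(L/K)) {x : L} (hx : Q.valuation L x ≤ 1) :
    Q.valuation L (σ x - x) < 1 := by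
  have hint (t : 𝓞 L) : Q.valuation L (σ (t : L) - t) < 1 :=
    (Q.valuation_lt_one_iff_mem (σ • t - t)).2 (hσ t)
  obtain ⟨a, ⟨s, hs⟩, hsx⟩ := Q.exists_primeCompl_mul_eq_of_integer x hx
  have hs1 : Q.valuation L (s : L) = 1 :=
    (Q.valuation_le_one s).antisymm (not_lt.1 fun h => hs ((Q.valuation_lt_one_iff_mem s).1 h))
  have hσs : Q.valuation L (σ (s : L)) = 1 := by
    rw [← hs1, ← sub_add_cancel (σ (s : L)) s]
    exact Valuation.map_add_eq_of_lt_right _ ((hint s).trans_eq hs1.symm)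
  have heq : σ (s : L) * (σ x - x) = (σ (a : L) - a) - (σ (s : L) - s) * x := by
    rw [show (a : L) = s * x from hsx.symm.trans (mul_comm _ _), map_mul]
    ring
  calc Q.valuation L (σ x - x) = Q.valuation L (σ (s : L) * (σ x - x)) := by
        rw [map_mul, hσs, one_mul]
    _ ≤ max (Q.valuation L (σ (a : L) - a)) (Q.valuation L ((σ (s : L) - s) * x)) := by
        rw [heq]
        exact Valuation.map_sub _ _ _
    _ < 1 := by
        refine max_lt (hint a) ?_
        rw [map_mul]
        exact mul_lt_one_of_nonneg_of_lt_one_left zero_le (hint s) hx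

variable [NumberField K]

theorem valuation_algebraMap_eq_pow_card_inertia {G : Type*} [Group G] [Finite G]
    [MulSemiringAction G (𝓞 L)] [IsGaloisGroup G (𝓞 K) (𝓞 L)] (p : HeightOneSpectrum (𝓞 K))
    (Q : HeightOneSpectrum (𝓞 L)) [Q.asIdeal.LiesOver p.asIdeal] (x : K) :
    Q.valuation L (algebraMap K L x) = p.valuation K x ^ Nat.card (Q.asIdeal.inertia G) := by
  have : Finite (𝓞 K ⧸ p.asIdeal) := Ring.HasFiniteQuotients.finiteQuotient p.ne_bot
  have := p.isMaximal
  rw [Ideal.card_inertia_eq_ramificationIdxIn p.asIdeal Q.asIdeal,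
    Ideal.ramificationIdxIn_eq_ramificationIdx p.asIdeal Q.asIdeal G,
    ← Ideal.ramificationIdx'_eq_ramificationIdx p.asIdeal Q.asIdeal p.ne_bot,
    HeightOneSpectrum.valuation_liesOver L p Q]

theorem exists_valuation_eq_pow_card_inertia [IsGalois K L] (Q : HeightOneSpectrum (𝓞 L)) (x : L)
    (hx : ∀ σ ∈ Q.asIdeal.inertia Gal(L/K), σ x = x) :
    ∃ z : ℤᵐ⁰, Q.valuation L x = z ^ Nat.card (Q.asIdeal.inertia Gal(L/K)) := by
  let I := Q.asIdeal.inertia Gal(L/K)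
  let E : IntermediateField K L := FixedPoints.intermediateField I
  have : IsGaloisGroup I E L := IsGaloisGroup.subgroup Gal(L/K) K L I
  have : IsGaloisGroup I (𝓞 E) (𝓞 L) := .of_isFractionRing _ _ _ E L
  let q : HeightOneSpectrum (𝓞 E) :=
    ⟨Q.asIdeal.under (𝓞 E), inferInstance, Ideal.IsIntegral.comap_ne_bot _ Q.ne_bot⟩
  have : Q.asIdeal.LiesOver q.asIdeal := ⟨rfl⟩
  have htop : Q.asIdeal.inertia I = ⊤ := by
    rw [eq_top_iff]
    exact fun σ _ => (Ideal.coe_mem_inertia ..).1 σ.2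
  let x' : E := ⟨x, fun σ => hx σ.1 σ.2⟩
  have hval := valuation_algebraMap_eq_pow_card_inertia (G := I) q Q x'
  rw [htop, Subgroup.card_top] at hval
  exact ⟨q.valuation E x', hval⟩

theorem nonempty_inertialExtension [IsGalois K L] (p : HeightOneSpectrum (𝓞 K)) :
    Nonempty (InertialExtension (p.valuation K) L) := by
  obtain ⟨⟨Q, hQ, hQp⟩⟩ := Ideal.nonempty_primesOver (S := 𝓞 L) p.asIdeal
  let Q : HeightOneSpectrum (𝓞 L) := ⟨Q, hQ, Ideal.ne_bot_of_liesOver_of_ne_bot p.ne_bot Q⟩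
  have : Q.asIdeal.LiesOver p.asIdeal := hQp
  exact ⟨{
    v := Q.valuation L
    e := _
    inertia := Q.asIdeal.inertia Gal(L/K)
    e_ne_zero := Nat.card_pos.ne'
    valuation_algebraMap := valuation_algebraMap_eq_pow_card_inertia p Q
    exists_eq_pow_of_fixed := exists_valuation_eq_pow_card_inertia Q
    valuation_sub_lt_one := valuation_apply_sub_lt_one Q }⟩

end NumberField

namespace InertialExtension

variable {K L : Type*} [Field K] [Field L] [Algebra K L] {w : Valuation K ℤᵐ⁰}
  (V : InertialExtension w L) {N : ℕ} {a : K} {k : ℤ}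

include V

theorem valuation_algebraMap_lt {x y : K} (h : w x < w y) :
    V.v (algebraMap K L x) < V.v (algebraMap K L y) := by
  rw [V.valuation_algebraMap, V.valuation_algebraMap]
  exact pow_lt_pow_left₀ h zero_le V.e_ne_zero

theorem one_lt_valuation_algebraMap {x : K} (h : 1 < w x) : 1 < V.v (algebraMap K L x) := by
  rw [V.valuation_algebraMap]
  exact one_lt_pow₀ h V.e_ne_zero

theorem valuation_algebraMap_eq_one {x : K} (h : w x = 1) : V.v (algebraMap K L x) = 1 := by
  rw [V.valuation_algebraMap, h, one_pow]

theorem dvd_card (hN : N ≠ 0) {O : Finset L} (hO : ∀ σ ∈ V.inertia, ∀ y ∈ O, σ y ∈ O)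
    (hv : ∀ y ∈ O, V.v y ^ N = V.v (algebraMap K L a)) (ha : w a = exp k)
    (hk : IsCoprime (N : ℤ) k) : N ∣ O.card := by
  have hfixed (σ) (hσ : σ ∈ V.inertia) : σ (∏ y ∈ O, y) = ∏ y ∈ O, y := by
    rw [map_prod]
    refine Finset.prod_nbij (fun y => σ y) (hO σ hσ) σ.injective.injOn (fun y hy => ?_)
      fun _ _ => rfl
    exact ⟨σ⁻¹ y, hO _ (inv_mem hσ) y hy, AlgEquiv.apply_symm_apply σ y⟩
  obtain ⟨z, hz⟩ := V.exists_eq_pow_of_fixed _ hfixed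
  have hpow : z ^ N = exp k ^ O.card := by
    refine (pow_left_inj₀ zero_le zero_le V.e_ne_zero).1 ?_
    rw [pow_right_comm, ← hz, map_prod, ← Finset.prod_pow, Finset.prod_congr rfl hv,
      Finset.prod_const, V.valuation_algebraMap, ha, pow_right_comm]
  have hz0 : z ≠ 0 := by
    rintro rfl
    exact pow_ne_zero _ exp_ne_zero (hpow.symm.trans (zero_pow hN))
  rw [← exp_log hz0, ← exp_nsmul, ← exp_nsmul, exp_inj, nsmul_eq_mul, nsmul_eq_mul] at hpow
  exact_mod_cast hk.dvd_of_dvd_mul_right ⟨_, hpow.symm⟩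

theorem encard_eq_and_inertia_transitive {S : Set L}
    (hS : ∀ σ ∈ V.inertia, ∀ y ∈ S, σ y ∈ S) (hcard : S.encard ≤ N)
    (hv : ∀ y ∈ S, V.v y ^ N = V.v (algebraMap K L a)) (ha : w a = exp k)
    (hk : IsCoprime (N : ℤ) k) {y : L} (hy : y ∈ S) :
    S.encard = N ∧ ∀ y' ∈ S, ∃ σ ∈ V.inertia, σ y = y' := by
  let O : Set L := {y' | ∃ σ ∈ V.inertia, σ y = y'}
  have hOS : O ⊆ S := by
    rintro _ ⟨σ, hσ, rfl⟩
    exact hS σ hσ y hy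
  have hyO : y ∈ O := ⟨1, one_mem _, rfl⟩
  have hSfin : S.Finite := Set.finite_of_encard_le_coe hcard
  obtain ⟨O', hO'⟩ := (hSfin.subset hOS).exists_finset_coe
  have hN : N ≠ 0 := by
    rintro rfl
    exact (Set.encard_pos.2 ⟨y, hy⟩).not_ge hcard
  have hdvd : N ∣ O'.card := by
    refine V.dvd_card hN (fun σ hσ z hz => ?_) (fun z hz => hv z (hOS (hO'.le hz))) ha hk
    obtain ⟨τ, hτ, rfl⟩ := hO'.le hz
    exact hO'.ge ⟨σ * τ, mul_mem hσ hτ, rfl⟩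
  have hNO : (N : ℕ∞) ≤ O.encard := by
    rw [← hO', Set.encard_coe_eq_coe_finsetCard]
    exact_mod_cast Nat.le_of_dvd (Finset.card_pos.2 ⟨y, hO'.ge hyO⟩) hdvd
  have hOeq : O = S := (hSfin.subset hOS).eq_of_subset_of_encard_le hOS (hcard.trans hNO)
  exact ⟨hcard.antisymm (hOeq ▸ hNO), fun y' hy' => hOeq.ge hy'⟩

end InertialExtension

end Inertia

section Ord

open IsDedekindDomain WithZero

variable {K : Type*} [Field K] [NumberField K] (p : HeightOneSpectrum (𝓞 K)) {x y : K}

theorem ord_eq_coe_iff {k : ℤ} : ord p x = k ↔ p.valuation K x = exp (-k) := by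
  unfold ord
  split_ifs with h
  · simp [h, exp_ne_zero.symm]
  · have hx : p.valuation K x ≠ 0 := (Valuation.ne_zero_iff _).2 h
    rw [WithTop.coe_inj, neg_eq_iff_eq_neg]
    exact ⟨fun h => by rw [← h, exp_log hx], fun h => by rw [h, log_exp]⟩

theorem ord_lt_ord_iff : ord p x < ord p y ↔ p.valuation K y < p.valuation K x := by
  unfold ord
  split_ifs with hx hy hy
  · simp [hx, hy]
  · simp [hx]
  · rw [hy, map_zero]
    exact iff_of_true (WithTop.coe_lt_top _) (zero_lt_iff.2 ((Valuation.ne_zero_iff _).2 hx))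
  · rw [WithTop.coe_lt_coe, neg_lt_neg_iff,
      log_lt_log ((Valuation.ne_zero_iff _).2 hy) ((Valuation.ne_zero_iff _).2 hx)]

theorem ord_one : ord p (1 : K) = 0 :=
  (ord_eq_coe_iff p (k := 0)).2 (by simp)

theorem ord_neg_iff : ord p x < 0 ↔ 1 < p.valuation K x := by
  rw [← ord_one p, ord_lt_ord_iff, map_one]

theorem ord_nonneg_iff : 0 ≤ ord p x ↔ p.valuation K x ≤ 1 := by
  rw [← not_lt, ord_neg_iff, not_lt]

theorem ord_eq_zero_iff : ord p x = 0 ↔ p.valuation K x = 1 := by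
  simpa using ord_eq_coe_iff p (x := x) (k := 0)

end Ord

section Trinomial

/-- The trinomial map `y ↦ y ^ d - b * y ^ m`. -/
def tri {R : Type*} [CommRing R] (d m : ℕ) (b y : R) : R := y ^ d - b * y ^ m

/-- The polynomial whose roots are the preimages of `a` under `tri d m b`. -/
noncomputable def fiberPoly {R : Type*} [CommRing R] (d m : ℕ) (b a : R) : R[X] :=
  X ^ d - C b * X ^ m - C a

section CommRing

variable {R S : Type*} [CommRing R] [CommRing S] {d m : ℕ} (b a : R)

theorem map_tri {F : Type*} [FunLike F R S] [RingHomClass F R S] (r : F) (y : R) :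
    r (tri d m b y) = tri d m (r b) (r y) := by
  simp [tri]

theorem map_tri_iterate {F : Type*} [FunLike F R S] [RingHomClass F R S] (r : F) (y : R) (n : ℕ) :
    r ((tri d m b)^[n] y) = (tri d m (r b))^[n] (r y) :=
  Function.Semiconj.iterate_right (fun y => map_tri b r y) n y

theorem eval_fiberPoly (y : R) : (fiberPoly d m b a).eval y = tri d m b y - a := by
  simp [fiberPoly, tri]

theorem map_fiberPoly (r : R →+* S) :
    (fiberPoly d m b a).map r = fiberPoly d m (r b) (r a) := by
  simp [fiberPoly]

theorem degree_lower_terms_lt (hm : 0 < m) (hmd : m < d) :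
    (C b * X ^ m + C a).degree < (d : WithBot ℕ) := by
  refine (degree_add_le _ _).trans_lt (max_lt ?_ ?_)
  · exact (degree_C_mul_X_pow_le _ _).trans_lt (Nat.cast_lt.2 hmd)
  · exact degree_C_le.trans_lt (Nat.cast_pos.2 (hm.trans hmd))

theorem monic_fiberPoly (hm : 0 < m) (hmd : m < d) : (fiberPoly d m b a).Monic := by
  rw [fiberPoly, sub_sub]
  exact monic_X_pow_sub (degree_lower_terms_lt b a hm hmd)

theorem natDegree_fiberPoly [Nontrivial R] (hm : 0 < m) (hmd : m < d) :
    (fiberPoly d m b a).natDegree = d := by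
  rw [fiberPoly, sub_sub, natDegree_eq_of_degree_eq (degree_sub_eq_left_of_degree_lt ?_),
    natDegree_X_pow]
  rw [degree_X_pow]
  exact degree_lower_terms_lt b a hm hmd

theorem mul_eval_derivative_fiberPoly (z : R) :
    z * (derivative (fiberPoly d m b a)).eval z = d * z ^ d - m * b * z ^ m := by
  have hpow : ∀ n : ℕ, z * (derivative (X ^ n : R[X])).eval z = n * z ^ n
    | 0 => by simp
    | n + 1 => by simp; ring
  simp only [fiberPoly, derivative_sub, derivative_C_mul, derivative_C, eval_sub, eval_mul, eval_C,
    eval_zero]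
  linear_combination hpow d - b * hpow m

theorem sq_mul_eval_derivative_derivative_fiberPoly (z : R) :
    z ^ 2 * (derivative (derivative (fiberPoly d m b a))).eval z =
      d * (d - 1) * z ^ d - m * (m - 1) * b * z ^ m := by
  have hpow : ∀ n : ℕ, z ^ 2 * (derivative (derivative (X ^ n : R[X]))).eval z =
      n * (n - 1) * z ^ n
    | 0 => by simp
    | 1 => by simp
    | n + 2 => by simp; ring
  simp only [fiberPoly, derivative_sub, derivative_C_mul, derivative_C, eval_sub, eval_mul, eval_C,
    derivative_zero, eval_zero]
  linear_combination hpow d - b * hpow m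

end CommRing

section Multiplicity

variable {k : Type*} [Field k] {d m : ℕ} {b a z : k}

theorem eq_of_one_lt_rootMultiplicity (h : 1 < (fiberPoly d m b a).rootMultiplicity z) :
    d * z ^ d = m * b * z ^ m := by
  have hroot := isRoot_iterate_derivative_of_lt_rootMultiplicity h
  rw [Function.iterate_one, IsRoot] at hroot
  rw [← sub_eq_zero, ← mul_eval_derivative_fiberPoly b a, hroot, mul_zero]

theorem rootMultiplicity_le_two (hd : (d : k) ≠ 0) (hdm : (d : k) ≠ m) (hz : z ≠ 0) :
    (fiberPoly d m b a).rootMultiplicity z ≤ 2 := by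
  by_contra! h
  have hroot := isRoot_iterate_derivative_of_lt_rootMultiplicity h
  rw [Function.iterate_succ_apply, Function.iterate_one, IsRoot] at hroot
  have hcrit := eq_of_one_lt_rootMultiplicity (one_lt_two.trans h)
  have hcrit' := sq_mul_eval_derivative_derivative_fiberPoly (d := d) (m := m) b a z
  rw [hroot, mul_zero] at hcrit'
  have hzero : d * (d - m) * z ^ d = 0 := by linear_combination -hcrit' - (m - 1) * hcrit
  exact mul_ne_zero (mul_ne_zero hd (sub_ne_zero.2 hdm)) (pow_ne_zero _ hz) hzero

theorem rootMultiplicity_zero_le_one (hm : 0 < m) (hmd : m < d) (hdm : (d : k) ≠ m) (hz : z ≠ 0) :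
    (fiberPoly d m b 0).rootMultiplicity z ≤ 1 := by
  by_contra! h
  have hroot := (rootMultiplicity_pos (monic_fiberPoly b 0 hm hmd).ne_zero).1 (one_pos.trans h)
  rw [IsRoot, eval_fiberPoly, tri] at hroot
  have hcrit := eq_of_one_lt_rootMultiplicity h
  have hzero : (d - m) * z ^ d = 0 := by linear_combination hcrit - m * hroot
  exact mul_ne_zero (sub_ne_zero.2 hdm) (pow_ne_zero _ hz) hzero

theorem rootMultiplicity_zero_eq (hmd : m < d) (hb : b ≠ 0) :
    (fiberPoly d m b 0).rootMultiplicity 0 = m := by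
  have hfactor : fiberPoly d m b 0 = (X ^ (d - m) - C b) * (X - C 0) ^ m := by
    rw [fiberPoly, C_0, sub_zero, sub_zero, sub_mul, ← pow_add, Nat.sub_add_cancel hmd.le]
  rw [hfactor, rootMultiplicity_mul_X_sub_C_pow (X_pow_sub_C_ne_zero (Nat.sub_pos_of_lt hmd) b),
    rootMultiplicity_eq_zero, zero_add]
  simpa [(Nat.sub_pos_of_lt hmd).ne'] using hb

theorem encard_fiber_le (hm : 0 < m) (hmd : m < d) (b a : k) :
    (tri d m b ⁻¹' {a}).encard ≤ d := by
  classical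
  have hne := (monic_fiberPoly b a hm hmd).ne_zero
  have hroots : tri d m b ⁻¹' {a} = (fiberPoly d m b a).roots.toFinset := by
    ext y
    simp [hne, eval_fiberPoly, sub_eq_zero]
  rw [hroots, Set.encard_coe_eq_coe_finsetCard, Nat.cast_le]
  exact (Multiset.toFinset_card_le _).trans
    ((card_roots' _).trans (natDegree_fiberPoly b a hm hmd).le)

theorem tri_iterate_mul {ζ : k} (hζ : ζ ^ d = ζ ^ m) (n : ℕ) (y : k) :
    (tri d m b)^[n] (ζ * y) = ζ ^ m ^ n * (tri d m b)^[n] y := by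
  induction n generalizing ζ y with
  | zero => simp
  | succ n ih =>
    have hstep : tri d m b (ζ * y) = ζ ^ m * tri d m b y := by
      simp only [tri, mul_pow, hζ]
      ring
    rw [Function.iterate_succ_apply, hstep, ih (by rw [pow_right_comm, hζ]), ← pow_mul,
      ← pow_succ', Function.iterate_succ_apply]

theorem eq_one_of_pow_eq_one_of_pow_eq_pow (hm : 0 < m) (hmd : m < d) (hcop : m.Coprime d) {ζ : k}
    {n : ℕ} (hn : ζ ^ m ^ n = 1) (hζ : ζ ^ d = ζ ^ m) : ζ = 1 := by
  have hζ0 : ζ ≠ 0 := by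
    rintro rfl
    exact zero_ne_one ((zero_pow (pow_pos hm n).ne').symm.trans hn)
  have hsub : ζ ^ (d - m) = 1 := by
    rw [pow_sub₀ _ hζ0 hmd.le, hζ, mul_inv_cancel₀ (pow_ne_zero m hζ0)]
  have hgcd : (m ^ n).gcd (d - m) = 1 := ((Nat.coprime_sub_self_right hmd.le).2 hcop).pow_left n
  rw [← pow_one ζ, ← hgcd]
  exact pow_gcd_eq_one.2 ⟨hn, hsub⟩

/-- Two nonzero critical points differ by a factor `ζ` with `ζ ^ d = ζ ^ m`, which each application
of the trinomial map raises to the power `m`. -/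
theorem critical_point_unique (hm : 0 < m) (hmd : m < d) (hcop : m.Coprime d)
    (hd : (d : k) ≠ 0) {n : ℕ} {z' : k}
    (hz0 : z ≠ 0) (hz : d * z ^ d = m * b * z ^ m) (hz' : d * z' ^ d = m * b * z' ^ m)
    (hn : (tri d m b)^[n] z = (tri d m b)^[n] z') (h0 : (tri d m b)^[n] z ≠ 0) : z = z' := by
  obtain ⟨ζ, rfl⟩ : ∃ ζ, z' = ζ * z := ⟨z' / z, (div_mul_cancel₀ _ hz0).symm⟩
  have hζ : ζ ^ d = ζ ^ m := by
    refine mul_right_cancel₀ (mul_ne_zero hd (pow_ne_zero d hz0)) ?_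
    linear_combination hz' - ζ ^ m * hz
  rw [tri_iterate_mul hζ, eq_comm, mul_eq_right₀ h0] at hn
  rw [eq_one_of_pow_eq_one_of_pow_eq_pow hm hmd hcop hn hζ, one_mul]

end Multiplicity

section Reduction

variable {A k : Type*} [CommRing A] [Field k] {d m n : ℕ} {b c : A}

theorem rootMultiplicity_map_prod_X_sub_C (r : A →+* k) (T : Finset A) (z : k) :
    ((∏ t ∈ T, (X - C t)).map r).rootMultiplicity z = {t ∈ (T : Set A) | r t = z}.ncard := by
  classical
  have hroots : ((∏ t ∈ T, (X - C t)).map r).roots = T.val.map r := by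
    rw [← roots_multiset_prod_X_sub_C (T.val.map r), Polynomial.map_prod, Finset.prod,
      Multiset.map_map]
    simp
  rw [← count_roots, hroots, Multiset.count_map, ← Finset.filter_val, Finset.card_val,
    ← Set.ncard_coe_finset]
  simp [eq_comm]

variable [IsDomain A]

theorem eq_prod_X_sub_C_of_card_eq {P : A[X]} (hP : P.Monic) {T : Finset A}
    (hT : ∀ t ∈ T, P.eval t = 0) (hcard : T.card = P.natDegree) : P = ∏ t ∈ T, (X - C t) := by
  have hle : T.val ≤ P.roots :=
    (Multiset.le_iff_subset T.nodup).2 fun t ht => (mem_roots hP.ne_zero).2 (hT t ht)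
  have hroots : T.val = P.roots :=
    Multiset.eq_of_le_of_card_le hle (P.card_roots'.trans hcard.ge)
  rw [← prod_multiset_X_sub_C_of_monic_of_roots_card_eq hP (by rw [← hroots]; exact hcard),
    ← hroots]
  rfl

theorem encard_fiber_inter_eq_rootMultiplicity (r : A →+* k) (hm : 0 < m) (hmd : m < d) {a : A}
    (hcard : (tri d m b ⁻¹' {a}).encard = d) (z : k) :
    {t | tri d m b t = a ∧ r t = z}.encard = (fiberPoly d m (r b) (r a)).rootMultiplicity z := by
  have hfin : (tri d m b ⁻¹' {a}).Finite := Set.finite_of_encard_eq_coe hcard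
  obtain ⟨T, hT⟩ := hfin.exists_finset_coe
  have hprod : fiberPoly d m b a = ∏ t ∈ T, (X - C t) := by
    refine eq_prod_X_sub_C_of_card_eq (monic_fiberPoly b a hm hmd) (fun t ht => ?_) ?_
    · rw [eval_fiberPoly, sub_eq_zero]
      exact (hT ▸ Finset.mem_coe.2 ht : t ∈ tri d m b ⁻¹' {a})
    · rw [natDegree_fiberPoly b a hm hmd]
      rw [← hT, Set.encard_coe_eq_coe_finsetCard] at hcard
      exact_mod_cast hcard
  rw [← map_fiberPoly, hprod, rootMultiplicity_map_prod_X_sub_C, hT, Set.Finite.cast_ncard_eq]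
  · rfl
  · exact hfin.subset (Set.sep_subset _ _)

variable {r : A →+* k} {y y' t t' : A}

theorem tri_eq_and_critical_of_map_eq (hm : 0 < m) (hmd : m < d)
    (hinj : Set.InjOn r (level (tri d m b) c n))
    (hfib : ∀ a ∈ level (tri d m b) c n, (tri d m b ⁻¹' {a}).encard = d)
    (hy : y ∈ level (tri d m b) c (n + 1)) (hy' : y' ∈ level (tri d m b) c (n + 1)) (hne : y ≠ y')
    (hr : r y = r y') :
    tri d m b y = tri d m b y' ∧ d * r y ^ d = m * r b * r y ^ m := by
  have heq : tri d m b y = tri d m b y' :=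
    hinj (mapsTo_level hy) (mapsTo_level hy') (by rw [map_tri, map_tri, hr])
  refine ⟨heq, eq_of_one_lt_rootMultiplicity (a := r (tri d m b y)) ?_⟩
  have hcount := encard_fiber_inter_eq_rootMultiplicity r hm hmd (hfib _ (mapsTo_level hy)) (r y)
  rw [← Nat.one_lt_cast (α := ℕ∞), ← hcount, Set.one_lt_encard_iff]
  exact ⟨y, y', ⟨rfl, rfl⟩, ⟨heq.symm, hr.symm⟩, hne⟩

theorem eq_or_eq_of_map_eq (hm : 0 < m) (hmd : m < d) (hcop : m.Coprime d) (hd : (d : k) ≠ 0)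
    (hdm : (d : k) ≠ m) (hc : r c ≠ 0) (hinj : Set.InjOn r (level (tri d m b) c n))
    (hfib : ∀ a ∈ level (tri d m b) c n, (tri d m b ⁻¹' {a}).encard = d)
    (hy : y ∈ level (tri d m b) c (n + 1)) (hy' : y' ∈ level (tri d m b) c (n + 1)) (hne : y ≠ y')
    (hr : r y = r y') (ht : t ∈ level (tri d m b) c (n + 1))
    (ht' : t' ∈ level (tri d m b) c (n + 1)) (hnet : t ≠ t') (hrt : r t = r t') :
    t = y ∨ t = y' := by
  have hiter {x : A} (hx : x ∈ level (tri d m b) c (n + 1)) :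
      (tri d m (r b))^[n + 1] (r x) = r c := by
    rw [← map_tri_iterate, mem_level.1 hx]
  have hy0 : r y ≠ 0 := by
    intro h0
    have hfixed : tri d m (r b) 0 = 0 := by simp [tri, hm.ne', (hm.trans hmd).ne']
    have hyc := hiter hy
    rw [h0, Function.iterate_fixed hfixed] at hyc
    exact hc hyc.symm
  obtain ⟨heq, hcrit⟩ := tri_eq_and_critical_of_map_eq hm hmd hinj hfib hy hy' hne hr
  obtain ⟨-, hcritt⟩ := tri_eq_and_critical_of_map_eq hm hmd hinj hfib ht ht' hnet hrt
  have hyt : r y = r t := critical_point_unique hm hmd hcop hd hy0 hcrit hcritt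
    ((hiter hy).trans (hiter ht).symm) ((hiter hy).trans_ne hc)
  by_contra! h
  have heqt := (tri_eq_and_critical_of_map_eq hm hmd hinj hfib hy ht h.1.symm hyt).1
  have hcount := encard_fiber_inter_eq_rootMultiplicity r hm hmd (hfib _ (mapsTo_level hy)) (r y)
  have htwo : {x | tri d m b x = tri d m b y ∧ r x = r y}.encard ≤ 2 :=
    hcount.trans_le (Nat.cast_le.2 (rootMultiplicity_le_two hd hdm hy0))
  refine (htwo.trans_lt (by norm_num)).not_ge (?_ : (3 : ℕ∞) ≤ _)
  rw [← Set.encard_eq_three.2 ⟨y, y', t, hne, h.1.symm, h.2.symm, rfl⟩]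
  refine Set.encard_le_encard ?_
  rintro x (rfl | rfl | rfl)
  exacts [⟨rfl, rfl⟩, ⟨heq.symm, hr.symm⟩, ⟨heqt.symm, hyt.symm⟩]

end Reduction

section Valuation

open IsLocalRing

variable {L Γ : Type*} [Field L] [LinearOrderedCommGroupWithZero Γ] {v : Valuation L Γ}
  {d m n : ℕ}

theorem residue_eq_residue_iff {x y : v.valuationSubring} :
    residue _ x = residue _ y ↔ v (x - y : L) < 1 := by
  rw [← sub_eq_zero, ← map_sub, residue_eq_zero_iff, Valuation.mem_maximalIdeal_iff]
  rfl

theorem residue_ne_zero_iff {x : v.valuationSubring} : residue _ x ≠ 0 ↔ v (x : L) = 1 := by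
  rw [ne_eq, residue_eq_zero_iff, Valuation.mem_maximalIdeal_iff, not_lt]
  exact ⟨x.2.antisymm, Eq.ge⟩

theorem valuation_le_one_of_tri (hmd : m < d) {b y : L} (hb : v b ≤ 1) (hy : v (tri d m b y) ≤ 1) :
    v y ≤ 1 := by
  by_contra! h
  have hlt : v (b * y ^ m) < v (y ^ d) := by
    rw [map_mul, map_pow, map_pow]
    exact (mul_le_of_le_one_left' hb).trans_lt (pow_lt_pow_right₀ h hmd)
  rw [tri, Valuation.map_sub_eq_of_lt_left _ hlt, map_pow] at hy
  exact hy.not_gt (one_lt_pow₀ h (Nat.ne_zero_of_lt hmd))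

theorem valuation_le_one_of_mem_level (hmd : m < d) {b c y : L} (hb : v b ≤ 1) (hc : v c ≤ 1)
    (hy : y ∈ level (tri d m b) c n) : v y ≤ 1 := by
  induction n generalizing y with
  | zero => exact (show y = c from hy) ▸ hc
  | succ n ih => exact valuation_le_one_of_tri hmd hb (ih (mapsTo_level hy))

theorem image_level_valuationSubring (hmd : m < d) (b c : v.valuationSubring) (n : ℕ) :
    Subtype.val '' level (tri d m b) c n = level (tri d m (b : L)) c n := by
  induction n with
  | zero => simp [level]
  | succ n ih =>
    have hcoe (y : v.valuationSubring) : tri d m (b : L) y = (tri d m b y : v.valuationSubring) :=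
      (map_tri b v.valuationSubring.subtype y).symm
    ext y
    constructor
    · rintro ⟨y, hy, rfl⟩
      exact mem_level.2 (by
        rw [Function.iterate_succ_apply, hcoe]
        exact ih.le ⟨_, mapsTo_level hy, rfl⟩)
    · intro hy
      obtain ⟨a, ha, hay⟩ := ih.ge (mapsTo_level hy)
      have hint : v y ≤ 1 := valuation_le_one_of_tri hmd b.2 (hay ▸ a.2)
      obtain rfl : a = tri d m b ⟨y, hint⟩ := Subtype.ext (hay.trans (hcoe ⟨y, hint⟩))
      exact ⟨⟨y, hint⟩, ha, rfl⟩

theorem encard_level_valuationSubring (hmd : m < d) (b c : v.valuationSubring) (n : ℕ) :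
    (level (tri d m b) c n).encard = (level (tri d m (b : L)) c n).encard := by
  rw [← image_level_valuationSubring hmd, Subtype.val_injective.encard_image]

theorem injOn_residue_level (hmd : m < d) {b c : v.valuationSubring}
    (hsub : ∀ y ∈ level (tri d m (b : L)) c n, ∀ y' ∈ level (tri d m (b : L)) c n, y ≠ y' →
      v (y - y') = 1) : Set.InjOn (residue v.valuationSubring) (level (tri d m b) c n) := by
  intro s hs t ht hst
  have hlevel := (image_level_valuationSubring hmd b c n).le
  by_contra hne
  exact (residue_eq_residue_iff.1 hst).ne (hsub s (hlevel ⟨s, hs, rfl⟩) t (hlevel ⟨t, ht, rfl⟩)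
    (Subtype.val_injective.ne hne))

end Valuation

end Trinomial

section Eisenstein

open WithZero

variable {d m n : ℕ}

theorem valuation_pow_eq_of_eisenstein {L Γ : Type*} [Field L] [LinearOrderedCommGroupWithZero Γ]
    (v : Valuation L Γ) (hm : 0 < m) (hmd : m < d) {b y : L} (hb : v b ≤ v (tri d m b y))
    (h0 : tri d m b y ≠ 0) (h1 : v (tri d m b y) < 1) : v y ^ d = v (tri d m b y) := by
  have hy : v y < 1 := by
    refine (valuation_le_one_of_tri hmd (hb.trans h1.le) h1.le).lt_of_ne fun hy => h1.ne ?_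
    have hlt : v (b * y ^ m) < v (y ^ d) := by
      rw [map_mul, map_pow, map_pow, hy, one_pow, one_pow, mul_one]
      exact hb.trans_lt h1
    rw [tri, Valuation.map_sub_eq_of_lt_left _ hlt, map_pow, hy, one_pow]
  have hlt : v (b * y ^ m) < v (tri d m b y) := by
    rw [map_mul, map_pow]
    exact (mul_le_mul_left hb _).trans_lt (mul_lt_of_lt_one_right
      (zero_lt_iff.2 ((Valuation.ne_zero_iff _).2 h0)) (pow_lt_one₀ zero_le hy hm.ne'))
  rw [← map_pow, ← sub_add_cancel (y ^ d) (b * y ^ m)]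
  exact Valuation.map_add_eq_of_lt_left _ hlt

theorem valuation_level_of_eisenstein {L Γ : Type*} [Field L] [LinearOrderedCommGroupWithZero Γ]
    (v : Valuation L Γ) (hm : 0 < m) (hmd : m < d) {b c y : L} (hb : v b ≤ v c) (h0 : c ≠ 0)
    (h1 : v c < 1) (hy : y ∈ level (tri d m b) c n) : v y ^ d ^ n = v c := by
  induction n generalizing y with
  | zero => rw [pow_zero, pow_one, show y = c from hy]
  | succ n ih =>
    have hstep := ih (mapsTo_level hy)
    have hpow : d ^ n ≠ 0 := pow_ne_zero _ (hm.trans hmd).ne'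
    have hF1 : v (tri d m b y) < 1 := (pow_lt_one_iff_of_nonneg zero_le hpow).1 (hstep.trans_lt h1)
    have hF0 : tri d m b y ≠ 0 := by
      rw [← v.ne_zero_iff, ← pow_ne_zero_iff hpow, hstep, v.ne_zero_iff]
      exact h0
    have hbF : v b ≤ v (tri d m b y) :=
      hb.trans (hstep.symm.trans_le (pow_le_of_le_one zero_le hF1.le hpow))
    rw [pow_succ', pow_mul, valuation_pow_eq_of_eisenstein v hm hmd hbF hF0 hF1, hstep]

variable {K L : Type*} [Field K] [Field L] [Algebra K L]

theorem tri_smul (b : K) (σ : Gal(L/K)) (x : L) :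
    tri d m (algebraMap K L b) (σ • x) = σ • tri d m (algebraMap K L b) x := by
  rw [AlgEquiv.smul_def, AlgEquiv.smul_def, map_tri, AlgEquiv.commutes]

theorem smul_mem_level (b c : K) (σ : Gal(L/K)) {x : L}
    (hx : x ∈ level (tri d m (algebraMap K L b)) (algebraMap K L c) n) :
    σ x ∈ level (tri d m (algebraMap K L b)) (algebraMap K L c) n :=
  (smul_mem_level_iff (tri_smul b) (fun σ => σ.commutes c) σ).2 hx

theorem encard_level_and_transitive_of_eisenstein {w : Valuation K ℤᵐ⁰}
    (V : InertialExtension w L) (hm : 0 < m) (hmd : m < d) {b c : K} (hb : w b ≤ w c)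
    (hc : w c = exp (-1)) {y : L}
    (hy : y ∈ level (tri d m (algebraMap K L b)) (algebraMap K L c) n) :
    (level (tri d m (algebraMap K L b)) (algebraMap K L c) n).encard = (d ^ n : ℕ) ∧
      ∀ y' ∈ level (tri d m (algebraMap K L b)) (algebraMap K L c) n,
        ∃ σ ∈ V.inertia, σ y = y' := by
  have hc0 : algebraMap K L c ≠ 0 := by
    rw [_root_.map_ne_zero, ← w.ne_zero_iff, hc]
    exact exp_ne_zero
  have hc1 : V.v (algebraMap K L c) < 1 := by
    rw [V.valuation_algebraMap, hc]
    exact pow_lt_one₀ zero_le (by decide) V.e_ne_zero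
  have hbc : V.v (algebraMap K L b) ≤ V.v (algebraMap K L c) := by
    rw [V.valuation_algebraMap, V.valuation_algebraMap]
    exact pow_le_pow_left' hb _
  exact V.encard_eq_and_inertia_transitive (fun σ _ y hy => smul_mem_level b c σ hy)
    (encard_level_le (encard_fiber_le hm hmd _) _ n)
    (fun y hy => valuation_level_of_eisenstein V.v hm hmd hbc hc0 hc1 hy) hc
    (isCoprime_one_right.neg_right) hy

end Eisenstein

section SmallBranch

open IsLocalRing WithZero

variable {L Γ : Type*} [Field L] [LinearOrderedCommGroupWithZero Γ] {v : Valuation L Γ}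
  {d m n : ℕ} {b c x y : L}

theorem tri_rescale (hmd : m < d) (b c y : L) :
    tri d m (b * c ^ (d - m)) (c * y) = c ^ d * tri d m b y := by
  simp only [tri]
  rw [← Nat.sub_add_cancel hmd.le, pow_add, Nat.add_sub_cancel, mul_pow, mul_pow, pow_add]
  ring

theorem encard_rescaled_fiber_inter (hm : 0 < m) (hmd : m < d) (hc0 : c ≠ 0)
    {b' a' : v.valuationSubring} (hb' : (b' : L) = b * c ^ (d - m)) (ha' : (a' : L) = c ^ d * x)
    (hcard : (tri d m b ⁻¹' {x}).encard = d) (z : v.valuationSubring) :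
    {y | tri d m b y = x ∧ v (c * y - z) < 1}.encard =
      (fiberPoly d m (residue _ b') (residue _ a')).rootMultiplicity (residue _ z) := by
  have hinj : Function.Injective (c * · : L → L) := mul_right_injective₀ hc0
  let B : Set L := {t | v (t - z) < 1}
  have hfiber : Subtype.val '' (tri d m b' ⁻¹' {a'}) = (c * ·) '' (tri d m b ⁻¹' {x}) := by
    refine (image_level_valuationSubring hmd b' a' 1).trans (Set.ext fun t => ?_)
    rw [← mul_inv_cancel_left₀ hc0 t, hinj.mem_set_image]
    change tri d m (b' : L) (c * (c⁻¹ * t)) = a' ↔ tri d m b (c⁻¹ * t) = x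
    rw [hb', ha', tri_rescale hmd, mul_right_inj' (pow_ne_zero d hc0)]
  calc {y | tri d m b y = x ∧ v (c * y - z) < 1}.encard
      = ((c * ·) '' (tri d m b ⁻¹' {x}) ∩ B).encard := by
        rw [← Set.image_inter_preimage, hinj.encard_image]
        rfl
    _ = {t | tri d m b' t = a' ∧ residue _ t = residue _ z}.encard := by
        rw [← hfiber, ← Set.image_inter_preimage, Subtype.val_injective.encard_image]
        simp only [residue_eq_residue_iff]
        rfl
    _ = (fiberPoly d m (residue _ b') (residue _ a')).rootMultiplicity (residue _ z) := by
        refine encard_fiber_inter_eq_rootMultiplicity _ hm hmd ?_ _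
        rw [← Subtype.val_injective.encard_image, hfiber, hinj.encard_image, hcard]

theorem valuation_rescaled_lt_one (hmd : m < d) (hc : v c ^ (d - m) * v b = 1) (hb : 1 < v b)
    (hx : v x < v b) : v (c ^ d * x) < 1 := by
  have hc1 : v c ≤ 1 := by
    by_contra! h
    exact (one_lt_mul_of_lt_of_le' (one_lt_pow₀ h (Nat.sub_pos_of_lt hmd).ne') hb.le).ne' hc
  have hc0 : 0 < v c ^ (d - m) := zero_lt_iff.2 (left_ne_zero_of_mul_eq_one hc)
  calc v (c ^ d * x) = v c ^ m * (v c ^ (d - m) * v x) := by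
        rw [map_mul, map_pow, ← mul_assoc, ← pow_add, Nat.add_sub_cancel' hmd.le]
    _ ≤ v c ^ (d - m) * v x := mul_le_of_le_one_left' (pow_le_one₀ zero_le hc1)
    _ < v c ^ (d - m) * v b := mul_lt_mul_of_pos_left hx hc0
    _ = 1 := hc

theorem exists_rescaled_coefficients (hmd : m < d) (hc : v c ^ (d - m) * v b = 1) (hb : 1 < v b)
    (hx : v x < v b) : ∃ b' a' : v.valuationSubring, (b' : L) = b * c ^ (d - m) ∧
      (a' : L) = c ^ d * x ∧ residue _ b' ≠ 0 ∧ residue _ a' = 0 := by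
  have hvb : v (b * c ^ (d - m)) = 1 := by rw [map_mul, map_pow, mul_comm, hc]
  have hva := valuation_rescaled_lt_one hmd hc hb hx
  refine ⟨⟨_, hvb.le⟩, ⟨_, hva.le⟩, rfl, rfl, residue_ne_zero_iff.2 hvb, ?_⟩
  exact (residue_eq_zero_iff _).2 ((Valuation.mem_maximalIdeal_iff _ _).2 hva)

theorem encard_small_fiber (hm : 0 < m) (hmd : m < d) (hc : v c ^ (d - m) * v b = 1)
    (hb : 1 < v b) (hx : v x < v b) (hcard : (tri d m b ⁻¹' {x}).encard = d) :
    {y | tri d m b y = x ∧ v (c * y) < 1}.encard = m := by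
  have hc0 : c ≠ 0 := by
    rintro rfl
    simp [Nat.sub_ne_zero_of_lt hmd] at hc
  obtain ⟨b', a', hb', ha', hres, hres'⟩ := exists_rescaled_coefficients hmd hc hb hx
  have hcount := encard_rescaled_fiber_inter hm hmd hc0 hb' ha' hcard 0
  rw [hres', map_zero, rootMultiplicity_zero_eq hmd hres] at hcount
  simpa using hcount

theorem valuation_rescaled_le_one (hmd : m < d) (hc : v c ^ (d - m) * v b = 1) (hb : 1 < v b)
    (hx : v x < v b) (hy : tri d m b y = x) : v (c * y) ≤ 1 := by
  obtain ⟨b', a', hb', ha', -, -⟩ := exists_rescaled_coefficients hmd hc hb hx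
  refine valuation_le_one_of_tri (b := (b' : L)) hmd b'.2 ?_
  rw [hb', tri_rescale hmd, hy, ← ha']
  exact a'.2

theorem eq_of_valuation_sub_lt_one_of_not_small (hm : 0 < m) (hmd : m < d)
    (hdm : v ((d : L) - m) = 1) (hc : v c ^ (d - m) * v b = 1) (hb : 1 < v b) (hx : v x < v b)
    (hcard : (tri d m b ⁻¹' {x}).encard = d) {y y' : L} (hy : tri d m b y = x)
    (hy' : tri d m b y' = x) (hsmall : ¬v (c * y) < 1) (hsub : v (c * y' - c * y) < 1) :
    y' = y := by
  have hc0 : c ≠ 0 := by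
    rintro rfl
    simp [Nat.sub_ne_zero_of_lt hmd] at hc
  obtain ⟨b', a', hb', ha', -, hres'⟩ := exists_rescaled_coefficients hmd hc hb hx
  have hint := valuation_rescaled_le_one hmd hc hb hx hy
  let z : v.valuationSubring := ⟨c * y, hint⟩
  have hz : residue _ z ≠ 0 := residue_ne_zero_iff.2 (hint.antisymm (not_lt.1 hsmall))
  have hdk : (d : ResidueField v.valuationSubring) ≠ m := by
    rw [← sub_ne_zero]
    simpa using residue_ne_zero_iff (x := (d - m : v.valuationSubring)).2 (by simpa using hdm)
  have hcount := encard_rescaled_fiber_inter hm hmd hc0 hb' ha' hcard z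
  rw [hres'] at hcount
  have hone := hcount.trans_le (Nat.cast_le.2 (rootMultiplicity_zero_le_one hm hmd hdk hz))
  rw [Nat.cast_one] at hone
  exact Set.encard_le_one_iff.1 hone y' y ⟨hy', hsub⟩ ⟨hy, by simp [z]⟩

theorem valuation_pow_lt_of_small (hmd : m < d) (hc : v c ^ (d - m) * v b = 1)
    (hy : v (c * y) < 1) : v y ^ (d - m) < v b := by
  refine lt_of_mul_lt_mul_left ?_ (zero_le : 0 ≤ v c ^ (d - m))
  rw [hc, ← mul_pow, ← map_mul]
  exact pow_lt_one₀ zero_le hy (Nat.sub_ne_zero_of_lt hmd)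

theorem valuation_lt_of_small (hmd : m < d) (hc : v c ^ (d - m) * v b = 1) (hb : 1 < v b)
    (hy : v (c * y) < 1) : v y < v b := by
  rcases le_total (v y) 1 with h | h
  · exact h.trans_lt hb
  · exact (le_self_pow₀ h (Nat.sub_ne_zero_of_lt hmd)).trans_lt
      (valuation_pow_lt_of_small hmd hc hy)

theorem valuation_tri_of_small (hmd : m < d) (hc : v c ^ (d - m) * v b = 1)
    (hy : v (c * y) < 1) : v (tri d m b y) = v y ^ m * v b := by
  have hfactor : tri d m b y = y ^ m * (y ^ (d - m) - b) := by
    rw [tri, mul_sub, ← pow_add, Nat.add_sub_cancel' hmd.le, mul_comm b]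
  have hlt : v (y ^ (d - m)) < v b := (map_pow v y _).trans_lt (valuation_pow_lt_of_small hmd hc hy)
  rw [hfactor, map_mul, map_pow, Valuation.map_sub_eq_of_lt_right _ hlt]

/-- The part of `level F x₀ n` lying on branches whose points `y` above `x₀` are all small, in the
sense that `v (c * y) < 1`. With `v c ^ (d - m) * v b = 1`, the other points of a
fibre have `v (c * y) = 1`. -/
def smallLevel (v : Valuation L Γ) (F : L → L) (c x₀ : L) : ℕ → Set L
  | 0 => {x₀}
  | n + 1 => {y | F y ∈ smallLevel v F c x₀ n ∧ v (c * y) < 1}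

variable {x₀ : L}

theorem smallLevel_subset_level {F : L → L} : smallLevel v F c x₀ n ⊆ level F x₀ n := by
  induction n with
  | zero => exact subset_rfl
  | succ n ih => exact fun y hy => ih hy.1

theorem valuation_lt_of_mem_smallLevel (hmd : m < d) (hc : v c ^ (d - m) * v b = 1) (hb : 1 < v b)
    (hx : v x₀ < v b) (hy : y ∈ smallLevel v (tri d m b) c x₀ n) : v y < v b := by
  cases n with
  | zero => exact (show y = x₀ from hy) ▸ hx
  | succ n => exact valuation_lt_of_small hmd hc hb hy.2

theorem encard_smallLevel_fiber (hm : 0 < m) (hmd : m < d) (hc : v c ^ (d - m) * v b = 1)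
    (hb : 1 < v b) (hx : v x₀ < v b)
    (hfib : ∀ y ∈ level (tri d m b) x₀ n, (tri d m b ⁻¹' {y}).encard = d)
    (hy : y ∈ smallLevel v (tri d m b) c x₀ n) :
    {z | tri d m b z = y ∧ v (c * z) < 1}.encard = m :=
  encard_small_fiber hm hmd hc hb (valuation_lt_of_mem_smallLevel hmd hc hb hx hy)
    (hfib y (smallLevel_subset_level hy))

theorem nonempty_smallLevel (hm : 0 < m) (hmd : m < d) (hc : v c ^ (d - m) * v b = 1)
    (hb : 1 < v b) (hx : v x₀ < v b)
    (hfib : ∀ i < n, ∀ y ∈ level (tri d m b) x₀ i, (tri d m b ⁻¹' {y}).encard = d) :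
    (smallLevel v (tri d m b) c x₀ n).Nonempty := by
  induction n with
  | zero => exact Set.singleton_nonempty x₀
  | succ n ih =>
    obtain ⟨y, hy⟩ := ih fun i hi => hfib i (hi.trans n.lt_succ_self)
    have hcard := encard_smallLevel_fiber hm hmd hc hb hx (hfib n n.lt_succ_self) hy
    obtain ⟨z, rfl, hz⟩ := Set.encard_ne_zero.1 (hcard.trans_ne (Nat.cast_ne_zero.2 hm.ne'))
    exact ⟨z, hy, hz⟩

theorem encard_smallLevel_le (hm : 0 < m) (hmd : m < d) (hc : v c ^ (d - m) * v b = 1)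
    (hb : 1 < v b) (hx : v x₀ < v b)
    (hfib : ∀ i < n, ∀ y ∈ level (tri d m b) x₀ i, (tri d m b ⁻¹' {y}).encard = d) :
    (smallLevel v (tri d m b) c x₀ n).encard ≤ (m ^ n : ℕ) := by
  induction n with
  | zero => simp [smallLevel]
  | succ n ih =>
    have hle := ih fun i hi => hfib i (hi.trans n.lt_succ_self)
    calc (smallLevel v (tri d m b) c x₀ (n + 1)).encard
        ≤ m * (smallLevel v (tri d m b) c x₀ n).encard := by
          refine encard_le_mul_of_mapsTo (Set.finite_of_encard_le_coe hle) (fun y hy => hy.1)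
            fun y hy => ?_
          rw [← encard_smallLevel_fiber hm hmd hc hb hx (hfib n n.lt_succ_self) hy]
          exact Set.encard_le_encard fun z hz => ⟨hz.2, hz.1.2⟩
      _ ≤ m * (m ^ n : ℕ) := mul_le_mul_right hle _
      _ = (m ^ (n + 1) : ℕ) := by rw [pow_succ', Nat.cast_mul]

theorem valuation_of_mem_smallLevel (hmd : m < d) (hc : v c ^ (d - m) * v b = 1)
    (hy : y ∈ smallLevel v (tri d m b) c x₀ n) :
    v y ^ m ^ n * v b ^ ∑ i ∈ Finset.range n, m ^ i = v x₀ := by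
  induction n generalizing y with
  | zero => rw [show y = x₀ from hy]; simp
  | succ n ih =>
    rw [← ih hy.1, valuation_tri_of_small hmd hc hy.2, mul_pow, ← pow_mul, ← pow_succ', mul_assoc,
      ← pow_add, Finset.sum_range_succ, add_comm (m ^ n)]

section Inertia

variable {K : Type*} [Field K] [Algebra K L] {w : Valuation K ℤᵐ⁰} {b c x₀ : K}

theorem smul_mem_smallLevel (V : InertialExtension w L) {σ : Gal(L/K)} (hσ : σ ∈ V.inertia)
    (hy : y ∈ smallLevel V.v (tri d m (algebraMap K L b)) (algebraMap K L c)
      (algebraMap K L x₀) n) :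
    σ y ∈ smallLevel V.v (tri d m (algebraMap K L b)) (algebraMap K L c) (algebraMap K L x₀) n := by
  induction n generalizing y with
  | zero =>
    rw [show y = algebraMap K L x₀ from hy, σ.commutes]
    rfl
  | succ n ih =>
    refine ⟨?_, ?_⟩
    · exact (tri_smul b σ y).symm ▸ ih hy.1
    · rw [← σ.commutes c, ← map_mul, ← sub_add_cancel (σ _) (algebraMap K L c * y)]
      exact Valuation.map_add_lt _ (V.valuation_sub_lt_one hσ hy.2.le) hy.2

theorem exists_exponent_coprime (n : ℕ) (hb : w b ≠ 0) {k : ℤ} (hk : w (x₀ / b) = exp k)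
    (hcop : IsCoprime (m : ℤ) k) :
    ∃ k' : ℤ, w (x₀ / b ^ ∑ i ∈ Finset.range (n + 1), m ^ i) = exp k' ∧
      IsCoprime ((m ^ (n + 1) : ℕ) : ℤ) k' := by
  refine ⟨k + m * -(↑(∑ i ∈ Finset.range n, m ^ i) * log (w b)), ?_, ?_⟩
  · rw [geom_sum_succ, pow_succ, div_mul_eq_div_div_swap, map_div₀, hk, map_pow, exp_add,
      div_eq_mul_inv, mul_neg, exp_neg, ← exp_log hb, ← exp_nsmul, log_exp]
    congr 3
    push_cast [nsmul_eq_mul]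
    ring
  · rw [Nat.cast_pow]
    exact ((IsCoprime.add_mul_left_right_iff).2 hcop).pow_left

theorem rescaling_algebraMap (V : InertialExtension w L) (hc : w c ^ (d - m) * w b = 1) :
    V.v (algebraMap K L c) ^ (d - m) * V.v (algebraMap K L b) = 1 := by
  rw [V.valuation_algebraMap, V.valuation_algebraMap, pow_right_comm, ← mul_pow, hc, one_pow]

theorem exists_inertia_apply_eq_of_mem_smallLevel (V : InertialExtension w L) (hm : 0 < m)
    (hmd : m < d) (hc : w c ^ (d - m) * w b = 1) (hb : 1 < w b) (hx : w x₀ < w b) {k : ℤ}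
    (hk : w (x₀ / b) = exp k) (hcop : IsCoprime (m : ℤ) k)
    (hfib : ∀ i ≤ n, ∀ y ∈ level (tri d m (algebraMap K L b)) (algebraMap K L x₀) i,
      (tri d m (algebraMap K L b) ⁻¹' {y}).encard = d) {y' : L}
    (hy : y ∈ smallLevel V.v (tri d m (algebraMap K L b)) (algebraMap K L c)
      (algebraMap K L x₀) (n + 1))
    (hy' : y' ∈ smallLevel V.v (tri d m (algebraMap K L b)) (algebraMap K L c)
      (algebraMap K L x₀) (n + 1)) : ∃ σ ∈ V.inertia, σ y = y' := by
  have hbL := V.one_lt_valuation_algebraMap hb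
  have hxL := V.valuation_algebraMap_lt hx
  have hcL := rescaling_algebraMap V hc
  obtain ⟨k', hk', hcop'⟩ := exists_exponent_coprime n (zero_le.trans_lt hb).ne' hk hcop
  refine (V.encard_eq_and_inertia_transitive (fun σ hσ y hy => smul_mem_smallLevel V hσ hy)
    (encard_smallLevel_le hm hmd hcL hbL hxL fun i hi => hfib i (Nat.le_of_lt_succ hi))
    (fun y hy => ?_) hk' hcop' hy).2 y' hy'
  rw [map_div₀, map_div₀, map_pow, map_pow, eq_div_iff (pow_ne_zero _ (zero_le.trans_lt hbL).ne')]
  exact valuation_of_mem_smallLevel hmd hcL hy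

theorem exists_fiber_part_transitive (V : InertialExtension w L) (hm : 0 < m) (hmd : m < d)
    (hdm : w ((d : K) - m) = 1) (hc : w c ^ (d - m) * w b = 1) (hb : 1 < w b) (hx : w x₀ < w b)
    {k : ℤ} (hk : w (x₀ / b) = exp k) (hcop : IsCoprime (m : ℤ) k)
    (hfib : ∀ i ≤ n, ∀ y ∈ level (tri d m (algebraMap K L b)) (algebraMap K L x₀) i,
      (tri d m (algebraMap K L b) ⁻¹' {y}).encard = d) :
    ∃ α ∈ level (tri d m (algebraMap K L b)) (algebraMap K L x₀) n,
      ∃ S ⊆ tri d m (algebraMap K L b) ⁻¹' {α}, S.encard = m ∧ ∀ s ∈ S, ∀ s' ∈ S,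
        ∃ σ : Gal(L/K), σ s = s' ∧
          ∀ t, tri d m (algebraMap K L b) t = α → t ∉ S → σ t = t := by
  have hbL := V.one_lt_valuation_algebraMap hb
  have hxL := V.valuation_algebraMap_lt hx
  have hcL := rescaling_algebraMap V hc
  have hdmL : V.v ((d : L) - m) = 1 := by
    simpa using V.valuation_algebraMap_eq_one hdm
  obtain ⟨α, hα⟩ := nonempty_smallLevel hm hmd hcL hbL hxL fun i hi => hfib i hi.le
  have hαb := valuation_lt_of_mem_smallLevel hmd hcL hbL hxL hα
  have hαfib := hfib n le_rfl α (smallLevel_subset_level hα)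
  refine ⟨α, smallLevel_subset_level hα, {t | tri d m (algebraMap K L b) t = α ∧
    V.v (algebraMap K L c * t) < 1}, fun t ht => ht.1, encard_small_fiber hm hmd hcL hbL hαb hαfib,
    fun s hs s' hs' => ?_⟩
  obtain ⟨σ, hσ, hss'⟩ := exists_inertia_apply_eq_of_mem_smallLevel V hm hmd hc hb hx hk hcop hfib
    ⟨hs.1.symm ▸ hα, hs.2⟩ ⟨hs'.1.symm ▸ hα, hs'.2⟩
  refine ⟨σ, hss', fun t ht htS => ?_⟩
  have hσt : tri d m (algebraMap K L b) (σ t) = α := by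
    rw [← AlgEquiv.smul_def, tri_smul, ht, ← hs.1, ← tri_smul, AlgEquiv.smul_def, hss', hs'.1, hs.1]
  refine eq_of_valuation_sub_lt_one_of_not_small hm hmd hdmL hcL hbL hαb hαfib ht hσt
    (fun h => htS ⟨ht, h⟩) ?_
  rw [← σ.commutes c, ← map_mul, σ.commutes]
  exact V.valuation_sub_lt_one hσ (valuation_rescaled_le_one hmd hcL hbL hαb ht)

end Inertia

end SmallBranch

section Discriminant

open Finset

theorem discr_map {R S : Type*} [CommRing R] [CommRing S] [Nontrivial S] (φ : R →+* S) {P : R[X]}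
    (hP : P.Monic) : (P.map φ).discr = φ P.discr := by
  rcases P.natDegree.eq_zero_or_pos with h0 | hpos
  · rw [hP.natDegree_eq_zero.1 h0, Polynomial.map_one, ← C_1, discr_C, ← C_1, discr_C, map_one]
  · have hres := congrArg φ (resultant_deriv (natDegree_pos_iff_degree_pos.1 hpos))
    have hnat := hP.natDegree_map φ
    have hres' := resultant_deriv (natDegree_pos_iff_degree_pos.1 (hpos.trans_eq hnat.symm))
    rw [hnat, derivative_map, resultant_map_map, hres, hP.leadingCoeff,
      (hP.map φ).leadingCoeff, mul_one, mul_one, map_mul, map_pow, map_neg, map_one] at hres'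
    exact (((isUnit_neg_one).pow _).mul_left_cancel hres').symm

variable {R : Type*} [CommRing R] {N : ℕ} (x : Fin N → R)

theorem eval_derivative_prod_X_sub_C (i : Fin N) :
    (∏ j, (X - C (x j))).derivative.eval (x i) = ∏ j ∈ {i}ᶜ, (x i - x j) := by
  rw [derivative_prod_finset, eval_finsetSum, sum_eq_single_of_mem i (mem_univ i)]
  · simp [eval_prod, compl_singleton]
  · intro j _ hji
    rw [eval_mul, eval_prod, prod_eq_zero (mem_erase.2 ⟨hji.symm, mem_univ i⟩) (by simp), zero_mul]

theorem prod_prod_compl_sub :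
    ∏ i, ∏ j ∈ {i}ᶜ, (x i - x j) =
      (-1) ^ (N * (N - 1) / 2) * (∏ i, ∏ j ∈ Ioi i, (x j - x i)) ^ 2 := by
  have hcard : ∑ i : Fin N, #(Ioi i) = N * (N - 1) / 2 := by
    simp only [Fin.card_Ioi]
    rw [Fin.sum_univ_eq_sum_range fun i => N - 1 - i, sum_range_reflect (fun i => i),
      sum_range_id]
  rw [← prod_prod_Ioi_mul_eq_prod_prod_off_diag fun j i => x i - x j, ← hcard,
    ← prod_pow_eq_pow_sum, ← prod_pow, ← prod_mul_distrib]
  refine prod_congr rfl fun i _ => ?_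
  rw [← prod_const, ← prod_pow, ← prod_mul_distrib]
  exact prod_congr rfl fun j _ => by ring

theorem discr_prod_X_sub_C [Nontrivial R] :
    (∏ i, (X - C (x i))).discr = (∏ i, ∏ j ∈ Ioi i, (x j - x i)) ^ 2 := by
  rcases N.eq_zero_or_pos with rfl | hN
  · simp [← C_1, -map_one]
  have hnat : (∏ i, (X - C (x i))).natDegree = N := by simp
  have hmonic : (∏ i, (X - C (x i))).Monic := monic_prod_X_sub_C _ _
  have hres := resultant_deriv (natDegree_pos_iff_degree_pos.1 (hN.trans_eq hnat.symm))
  rw [resultant_prod_left _ _ _ _ (by simp) (natDegree_derivative_le _), hmonic.leadingCoeff,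
    mul_one, hnat] at hres
  refine ((isUnit_neg_one).pow _).mul_left_cancel (hres.symm.trans ?_)
  rw [← prod_prod_compl_sub]
  refine prod_congr rfl fun i _ => ?_
  rw [natDegree_X_sub_C, resultant_X_sub_C_left _ _ _
    ((natDegree_derivative_le _).trans_eq (by rw [hnat])), eval_derivative_prod_X_sub_C]

end Discriminant

section Iterate

variable {K L : Type*} [Field K] [Field L] [Algebra K L] {d m n : ℕ}

theorem iter_succ (f : K[X]) (n : ℕ) : iter f (n + 1) = f.comp (iter f n) :=
  Function.iterate_succ_apply' _ _ _

theorem aeval_iter (f : K[X]) (n : ℕ) (y : L) :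
    aeval y (iter f n) = (fun z => aeval z f)^[n] y := by
  induction n with
  | zero => simp [iter]
  | succ n ih => rw [iter_succ, aeval_comp, ih, Function.iterate_succ_apply']

theorem natDegree_iter (f : K[X]) (n : ℕ) : (iter f n).natDegree = f.natDegree ^ n := by
  rw [iter, natDegree_iterate_comp, natDegree_X, mul_one]

theorem monic_iter {f : K[X]} (hf : f.Monic) (hd : f.natDegree ≠ 0) (n : ℕ) :
    (iter f n).Monic := by
  induction n with
  | zero => exact monic_X
  | succ n ih =>
    rw [iter_succ]
    exact hf.comp ih (by rw [natDegree_iter]; exact pow_ne_zero _ hd)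

theorem monic_iter_sub_C {f : K[X]} (hf : f.Monic) (hd : f.natDegree ≠ 0) (n : ℕ) (c : K) :
    (iter f n - C c).Monic := by
  refine (monic_iter hf hd n).sub_of_left (degree_C_le.trans_lt ?_)
  rw [← natDegree_pos_iff_degree_pos, natDegree_iter]
  exact pow_pos (Nat.pos_of_ne_zero hd) n

theorem monic_trinomial (hm : 0 < m) (hmd : m < d) (b : K) : (X ^ d - C b * X ^ m).Monic := by
  simpa [fiberPoly] using monic_fiberPoly b 0 hm hmd

theorem natDegree_trinomial (hm : 0 < m) (hmd : m < d) (b : K) :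
    (X ^ d - C b * X ^ m).natDegree = d := by
  simpa [fiberPoly] using natDegree_fiberPoly b 0 hm hmd

theorem monic_iter_trinomial_sub_C (hm : 0 < m) (hmd : m < d) (b c : K) :
    (iter (X ^ d - C b * X ^ m) n - C c).Monic :=
  monic_iter_sub_C (monic_trinomial hm hmd b)
    ((natDegree_trinomial hm hmd b).trans_ne (hm.trans hmd).ne') n c

theorem aeval_iter_trinomial_sub_C_eq_zero_iff {b c : K} {y : L} :
    aeval y (iter (X ^ d - C b * X ^ m) n - C c) = 0 ↔
      y ∈ level (tri d m (algebraMap K L b)) (algebraMap K L c) n := by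
  have htri : (fun z : L => aeval z (X ^ d - C b * X ^ m)) = tri d m (algebraMap K L b) := by
    ext z
    simp [tri]
  rw [map_sub, aeval_C, sub_eq_zero, aeval_iter, htri, mem_level]

theorem eq_prod_X_sub_C_of_injective {A : Type*} [CommRing A] [IsDomain A] {P : A[X]}
    (hP : P.Monic) {N : ℕ} (hN : P.natDegree = N) {x : Fin N → A} (hinj : Function.Injective x)
    (hx : ∀ i, P.eval (x i) = 0) : P = ∏ i, (X - C (x i)) := by
  refine (eq_prod_X_sub_C_of_card_eq hP (T := Finset.univ.map ⟨x, hinj⟩) ?_ ?_).trans ?_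
  · simpa using hx
  · simp [hN]
  · simp

theorem exists_enumeration_and_discr (hm : 0 < m) (hmd : m < d) {b c : K}
    (hcard : (level (tri d m (algebraMap K L b)) (algebraMap K L c) n).encard = (d ^ n : ℕ)) :
    ∃ x : Fin (d ^ n) → L, Function.Injective x ∧
      Set.range x = level (tri d m (algebraMap K L b)) (algebraMap K L c) n ∧
      algebraMap K L (iter (X ^ d - C b * X ^ m) n - C c).discr =
        (∏ i, ∏ j ∈ Finset.Ioi i, (x j - x i)) ^ 2 := by
  obtain ⟨x, hinj, hrange⟩ := exists_injective_range_eq_of_encard_eq hcard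
  have hmonic := monic_iter_trinomial_sub_C (n := n) hm hmd b c
  refine ⟨x, hinj, hrange, ?_⟩
  rw [← discr_map _ hmonic, ← discr_prod_X_sub_C]
  refine congrArg discr (eq_prod_X_sub_C_of_injective (hmonic.map _) ?_ hinj fun i => ?_)
  · rw [hmonic.natDegree_map, natDegree_sub_C, natDegree_iter, natDegree_trinomial hm hmd]
  · rw [eval_map_algebraMap, aeval_iter_trinomial_sub_C_eq_zero_iff, ← hrange]
    exact Set.mem_range_self i

end Iterate

section Transposition

open IsLocalRing WithZero

theorem eq_swap_of_moved {X : Type*} [DecidableEq X] {f : X → X} (hf : Function.Injective f)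
    {S : Set X} (hS : Set.MapsTo f S S) {y : X} (hy : y ∈ S) (hne : f y ≠ y)
    (hmoved : ∀ t ∈ S, f t ≠ t → t = y ∨ t = f y) {t : X} (ht : t ∈ S) :
    f t = Equiv.swap y (f y) t := by
  have hfy : f (f y) = y :=
    (hmoved _ (hS (hS hy)) (hf.ne (hf.ne hne))).resolve_right (hf.ne hne)
  by_cases h : f t = t
  · have hty : t ≠ y := fun heq => hne (heq ▸ h)
    have htfy : t ≠ f y := fun heq => hne (heq ▸ hf (heq ▸ h))
    rw [Equiv.swap_apply_of_ne_of_ne hty htfy, h]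
  · rcases hmoved t ht h with rfl | rfl
    · rw [Equiv.swap_apply_left]
    · rw [Equiv.swap_apply_right, hfy]

variable {K L : Type*} [Field K] [Field L] [Algebra K L] {d m n : ℕ} {b c : K} {y y' : L}

theorem valuation_sub_eq_one_of_discr {Γ : Type*} [LinearOrderedCommGroupWithZero Γ]
    {v : Valuation L Γ} (hm : 0 < m) (hmd : m < d) (hb : v (algebraMap K L b) ≤ 1)
    (hc : v (algebraMap K L c) ≤ 1)
    (hcard : (level (tri d m (algebraMap K L b)) (algebraMap K L c) n).encard = (d ^ n : ℕ))
    (hdisc : v (algebraMap K L (iter (X ^ d - C b * X ^ m) n - C c).discr) = 1)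
    (hy : y ∈ level (tri d m (algebraMap K L b)) (algebraMap K L c) n)
    (hy' : y' ∈ level (tri d m (algebraMap K L b)) (algebraMap K L c) n) (hne : y ≠ y') :
    v (y - y') = 1 := by
  obtain ⟨x, hinj, hrange, hx⟩ := exists_enumeration_and_discr hm hmd hcard
  have hint (i) : v (x i) ≤ 1 :=
    valuation_le_one_of_mem_level hmd hb hc (hrange.le (Set.mem_range_self i))
  have hle (i j) : v (x j - x i) ≤ 1 := (Valuation.map_sub _ _ _).trans (max_le (hint j) (hint i))
  rw [hx, map_pow, pow_eq_one_iff_of_nonneg zero_le two_ne_zero, map_prod] at hdisc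
  simp only [map_prod] at hdisc
  have hprod := (Finset.prod_eq_one_iff_of_le_one' fun i _ =>
    Finset.prod_le_one' fun j _ => hle i j).1 hdisc
  have hlt {i j} (hij : i < j) : v (x j - x i) = 1 :=
    (Finset.prod_eq_one_iff_of_le_one' fun j _ => hle i j).1 (hprod i (Finset.mem_univ i)) j
      (Finset.mem_Ioi.2 hij)
  obtain ⟨i, rfl⟩ := hrange.ge hy
  obtain ⟨j, rfl⟩ := hrange.ge hy'
  rcases lt_or_gt_of_ne (hinj.ne_iff.1 hne) with h | h
  · rw [Valuation.map_sub_swap, hlt h]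
  · exact hlt h

variable {w : Valuation K ℤᵐ⁰} (V : InertialExtension w L)

include V

theorem exists_mem_inertia_apply_ne_of_odd (hm : 0 < m) (hmd : m < d)
    (hcard : (level (tri d m (algebraMap K L b)) (algebraMap K L c) n).encard = (d ^ n : ℕ)) {k : ℤ}
    (hdisc : w (iter (X ^ d - C b * X ^ m) n - C c).discr = exp k) (hk : Odd k) :
    ∃ σ ∈ V.inertia, ∃ y ∈ level (tri d m (algebraMap K L b)) (algebraMap K L c) n, σ y ≠ y := by
  obtain ⟨x, -, hrange, hx⟩ := exists_enumeration_and_discr hm hmd hcard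
  by_contra! hfixed
  obtain ⟨z, hz⟩ := V.exists_eq_pow_of_fixed (∏ i, ∏ j ∈ Finset.Ioi i, (x j - x i))
    fun σ hσ => by
      have hσx (i) : σ (x i) = x i := hfixed σ hσ _ (hrange.le (Set.mem_range_self i))
      simp only [map_prod, map_sub, hσx]
  have hsq : exp k = z ^ 2 := by
    refine (pow_left_inj₀ zero_le zero_le V.e_ne_zero).1 ?_
    rw [← hdisc, ← V.valuation_algebraMap, hx, map_pow, hz, pow_right_comm]
  have hz0 : z ≠ 0 := by
    rintro rfl
    exact exp_ne_zero (hsq.trans (zero_pow two_ne_zero))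
  rw [← exp_log hz0, ← exp_nsmul, exp_inj, nsmul_eq_mul] at hsq
  exact Int.not_even_iff_odd.2 hk (hsq ▸ even_two.mul_right _)

theorem eq_or_eq_apply_of_apply_ne (hm : 0 < m) (hmd : m < d) (hcop : m.Coprime d) (hb : w b ≤ 1)
    (hc : w c = 1) (hd : w (d : K) = 1) (hdm : w ((d : K) - m) = 1)
    (hcard : (level (tri d m (algebraMap K L b)) (algebraMap K L c) n).encard = (d ^ n : ℕ))
    (hcard' : (level (tri d m (algebraMap K L b)) (algebraMap K L c) (n + 1)).encard =
      (d ^ (n + 1) : ℕ))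
    (hdisc : w (iter (X ^ d - C b * X ^ m) n - C c).discr = 1) {σ : Gal(L/K)} (hσ : σ ∈ V.inertia)
    (hy : y ∈ level (tri d m (algebraMap K L b)) (algebraMap K L c) (n + 1)) (hne : σ y ≠ y)
    (hy' : y' ∈ level (tri d m (algebraMap K L b)) (algebraMap K L c) (n + 1))
    (hne' : σ y' ≠ y') : y' = y ∨ y' = σ y := by
  have hbL : V.v (algebraMap K L b) ≤ 1 := by
    rw [V.valuation_algebraMap]
    exact pow_le_one₀ zero_le hb
  have hcL := V.valuation_algebraMap_eq_one hc
  let bA : V.v.valuationSubring := ⟨algebraMap K L b, hbL⟩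
  let cA : V.v.valuationSubring := ⟨algebraMap K L c, hcL.le⟩
  have hlevel (i) : Subtype.val '' level (tri d m bA) cA i = _ :=
    image_level_valuationSubring hmd bA cA i
  have hinj : Set.InjOn (residue V.v.valuationSubring) (level (tri d m bA) cA n) :=
    injOn_residue_level hmd fun y hy y' hy' => valuation_sub_eq_one_of_discr hm hmd hbL hcL.le
      hcard (V.valuation_algebraMap_eq_one hdisc) hy hy'
  have hfib : ∀ a ∈ level (tri d m bA) cA n, (tri d m bA ⁻¹' {a}).encard = d := by
    intro a ha
    refine (encard_level_valuationSubring hmd bA a 1).trans ?_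
    exact encard_fiber_of_encard_level (encard_fiber_le hm hmd _) hcard hcard'
      ((hlevel n).le ⟨a, ha, rfl⟩)
  have hdA : residue V.v.valuationSubring d ≠ 0 :=
    residue_ne_zero_iff.2 (by simpa using V.valuation_algebraMap_eq_one hd)
  have hdmA : residue V.v.valuationSubring (d - m) ≠ 0 :=
    residue_ne_zero_iff.2 (by simpa using V.valuation_algebraMap_eq_one hdm)
  rw [map_natCast] at hdA
  rw [map_sub, map_natCast, map_natCast, sub_ne_zero] at hdmA
  have hlift {t : L} (ht : t ∈ level (tri d m (algebraMap K L b)) (algebraMap K L c) (n + 1)) :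
      ∃ s ∈ level (tri d m bA) cA (n + 1), (s : L) = t := (hlevel (n + 1)).ge ht
  obtain ⟨s, hs, rfl⟩ := hlift hy
  obtain ⟨s', hs', rfl⟩ := hlift hy'
  obtain ⟨t, ht, hts⟩ := hlift (smul_mem_level b c σ hy)
  obtain ⟨t', ht', hts'⟩ := hlift (smul_mem_level b c σ hy')
  rw [← hts] at hne ⊢
  rw [← hts'] at hne'
  have hst {s t : V.v.valuationSubring} (h : (t : L) = σ s) : residue _ s = residue _ t := by
    refine (residue_eq_residue_iff.2 ?_).symm
    rw [h]
    exact V.valuation_sub_lt_one hσ s.2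
  exact (eq_or_eq_of_map_eq hm hmd hcop hdA hdmA (residue_ne_zero_iff.2 hcL) hinj hfib hs ht
    (Subtype.val_injective.ne_iff.1 hne).symm (hst hts) hs' ht'
    (Subtype.val_injective.ne_iff.1 hne').symm (hst hts')).imp (congrArg _) (congrArg _)

theorem exists_transposition [DecidableEq L] (hm : 0 < m) (hmd : m < d) (hcop : m.Coprime d)
    (hb : w b ≤ 1) (hc : w c = 1) (hd : w (d : K) = 1) (hdm : w ((d : K) - m) = 1)
    (hcard : (level (tri d m (algebraMap K L b)) (algebraMap K L c) n).encard = (d ^ n : ℕ))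
    (hcard' : (level (tri d m (algebraMap K L b)) (algebraMap K L c) (n + 1)).encard =
      (d ^ (n + 1) : ℕ))
    (hdisc : w (iter (X ^ d - C b * X ^ m) n - C c).discr = 1) {k : ℤ}
    (hdisc' : w (iter (X ^ d - C b * X ^ m) (n + 1) - C c).discr = exp k) (hk : Odd k) :
    ∃ σ : Gal(L/K), ∃ y ∈ level (tri d m (algebraMap K L b)) (algebraMap K L c) (n + 1),
      ∃ y' ∈ level (tri d m (algebraMap K L b)) (algebraMap K L c) (n + 1), y ≠ y' ∧
      ∀ t ∈ level (tri d m (algebraMap K L b)) (algebraMap K L c) (n + 1),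
        σ t = Equiv.swap y y' t := by
  obtain ⟨σ, hσ, y, hy, hne⟩ := exists_mem_inertia_apply_ne_of_odd V hm hmd hcard' hdisc' hk
  refine ⟨σ, y, hy, σ y, smul_mem_level b c σ hy, hne.symm, fun t ht => ?_⟩
  exact eq_swap_of_moved σ.injective (fun t => smul_mem_level b c σ) hy hne
    (fun t ht hne' => eq_or_eq_apply_of_apply_ne V hm hmd hcop hb hc hd hdm hcard hcard' hdisc hσ
      hy hne ht hne') ht

end Transposition

section Conditions

open IsDedekindDomain WithZero

variable {K L : Type*} [Field K] [NumberField K] [Field L] [NumberField L] [Algebra K L]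
  [IsGalois K L] {d m n : ℕ} {b x₀ : K} (p : HeightOneSpectrum (𝓞 K))

theorem valuation_eq_one_of_notMem {x : 𝓞 K} (hx : x ∉ p.asIdeal) : p.valuation K (x : K) = 1 :=
  (p.valuation_le_one x).antisymm
    (not_lt.1 fun h => hx ((HeightOneSpectrum.valuation_lt_one_iff_mem _ _).1 h))

theorem exists_pow_mul_valuation_eq_one {e : ℕ} {j : ℤ} (hb : p.valuation K b = exp (-(e * j))) :
    ∃ c : K, p.valuation K c ^ e * p.valuation K b = 1 := by
  obtain ⟨π, hπ⟩ := p.valuation_exists_uniformizer K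
  refine ⟨π ^ (-j), ?_⟩
  rw [map_zpow₀, hπ, hb, ← exp_zsmul, ← exp_nsmul, ← exp_add, ← exp_zero, exp_inj]
  simp

theorem encard_level_and_transitive_of_ord (hm : 0 < m) (hmd : m < d) (hb : 1 ≤ ord p b)
    (hx₀ : ord p x₀ = 1) {y : L}
    (hy : y ∈ level (tri d m (algebraMap K L b)) (algebraMap K L x₀) n) :
    (level (tri d m (algebraMap K L b)) (algebraMap K L x₀) n).encard = (d ^ n : ℕ) ∧
      ∀ y' ∈ level (tri d m (algebraMap K L b)) (algebraMap K L x₀) n,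
        ∃ σ : Gal(L/K), σ y = y' := by
  obtain ⟨V⟩ := nonempty_inertialExtension (L := L) p
  have hbx : p.valuation K b ≤ p.valuation K x₀ :=
    not_lt.1 fun h => ((ord_lt_ord_iff p).2 h).not_ge (hx₀.trans_le hb)
  obtain ⟨hcard, htrans⟩ := encard_level_and_transitive_of_eisenstein V hm hmd hbx
    ((ord_eq_coe_iff p (k := 1)).1 hx₀) hy
  exact ⟨hcard, fun y' hy' => (htrans y' hy').imp fun σ hσ => hσ.2⟩

theorem exists_fiber_part_transitive_of_ord (hm : 0 < m) (hmd : m < d)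
    (hp : (d : 𝓞 K) - m ∉ p.asIdeal) (hb : ord p b < min (ord p x₀) 0)
    (hdvd : ∃ k : ℤ, ord p b = k ∧ (d : ℤ) - m ∣ k)
    (hgcd : ∃ k : ℤ, ord p (x₀ / b) = k ∧ Int.gcd m k = 1)
    (hfib : ∀ i ≤ n, ∀ y ∈ level (tri d m (algebraMap K L b)) (algebraMap K L x₀) i,
      (tri d m (algebraMap K L b) ⁻¹' {y}).encard = d) :
    ∃ α ∈ level (tri d m (algebraMap K L b)) (algebraMap K L x₀) n,
      ∃ S ⊆ tri d m (algebraMap K L b) ⁻¹' {α}, S.encard = m ∧ ∀ s ∈ S, ∀ s' ∈ S,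
        ∃ σ : Gal(L/K), σ s = s' ∧
          ∀ t, tri d m (algebraMap K L b) t = α → t ∉ S → σ t = t := by
  obtain ⟨V⟩ := nonempty_inertialExtension (L := L) p
  obtain ⟨hbx, hb0⟩ := lt_min_iff.1 hb
  obtain ⟨_, hk, j, rfl⟩ := hdvd
  obtain ⟨l, hl, hml⟩ := hgcd
  rw [← Nat.cast_sub hmd.le, ord_eq_coe_iff] at hk
  obtain ⟨c, hc⟩ := exists_pow_mul_valuation_eq_one p hk
  exact exists_fiber_part_transitive V hm hmd (by simpa using valuation_eq_one_of_notMem p hp) hc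
    ((ord_neg_iff p).1 hb0) ((ord_lt_ord_iff p).1 hbx) ((ord_eq_coe_iff p).1 hl)
    (Int.isCoprime_iff_gcd_eq_one.2 hml).neg_right hfib

theorem exists_transposition_of_ord [DecidableEq L] (hm : 0 < m) (hmd : m < d)
    (hcop : m.Coprime d) (hb : 0 ≤ ord p b) (hx₀ : ord p x₀ = 0) (hd : (d : 𝓞 K) ∉ p.asIdeal)
    (hdm : (d : 𝓞 K) - m ∉ p.asIdeal)
    (hcard : ∀ i ≤ n + 1,
      (level (tri d m (algebraMap K L b)) (algebraMap K L x₀) i).encard = (d ^ i : ℕ))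
    (hdisc : ord p (iter (X ^ d - C b * X ^ m) n - C x₀).discr = 0)
    (hodd : ∃ k : ℤ, ord p (iter (X ^ d - C b * X ^ m) (n + 1) - C x₀).discr = k ∧ Odd k) :
    ∃ σ : Gal(L/K), ∃ y ∈ level (tri d m (algebraMap K L b)) (algebraMap K L x₀) (n + 1),
      ∃ y' ∈ level (tri d m (algebraMap K L b)) (algebraMap K L x₀) (n + 1), y ≠ y' ∧
      ∀ t ∈ level (tri d m (algebraMap K L b)) (algebraMap K L x₀) (n + 1),
        σ t = Equiv.swap y y' t := by
  obtain ⟨V⟩ := nonempty_inertialExtension (L := L) p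
  obtain ⟨k, hk, hkodd⟩ := hodd
  exact exists_transposition V hm hmd hcop ((ord_nonneg_iff p).1 hb) ((ord_eq_zero_iff p).1 hx₀)
    (by simpa using valuation_eq_one_of_notMem p hd)
    (by simpa using valuation_eq_one_of_notMem p hdm) (hcard n n.le_succ) (hcard _ le_rfl)
    ((ord_eq_zero_iff p).1 hdisc) ((ord_eq_coe_iff p).1 hk) hkodd.neg

theorem ord_div_eq_zero {x y : 𝓞 K} (hx : x ∉ p.asIdeal) (hy : y ∉ p.asIdeal) :
    ord p ((x : K) / y) = 0 := by
  rw [ord_eq_zero_iff, map_div₀, valuation_eq_one_of_notMem p hx, valuation_eq_one_of_notMem p hy,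
    div_one]

end Conditions

section SplittingField

variable {K L : Type*} [Field K] [Field L] [Algebra K L] {d m n : ℕ} {b c : K}

theorem nonempty_level (hm : 0 < m) (hmd : m < d)
    [IsSplittingField K L (iter (X ^ d - C b * X ^ m) n - C c)] {i : ℕ} (hi : i ≤ n) :
    (level (tri d m (algebraMap K L b)) (algebraMap K L c) i).Nonempty := by
  have hdeg : (iter (X ^ d - C b * X ^ m) n - C c).natDegree = d ^ n := by
    rw [natDegree_sub_C, natDegree_iter, natDegree_trinomial hm hmd]
  have hpos : 0 < (iter (X ^ d - C b * X ^ m) n - C c).natDegree :=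
    hdeg ▸ pow_pos (hm.trans hmd) n
  obtain ⟨y, hy⟩ := (IsSplittingField.splits L
    (iter (X ^ d - C b * X ^ m) n - C c)).exists_eval_eq_zero (by
      rw [degree_map]
      exact (natDegree_pos_iff_degree_pos.1 hpos).ne')
  rw [eval_map_algebraMap, aeval_iter_trinomial_sub_C_eq_zero_iff] at hy
  refine ⟨(tri d m (algebraMap K L b))^[n - i] y, mem_level.2 ?_⟩
  rw [← Function.iterate_add_apply, Nat.add_sub_cancel' hi]
  exact hy

theorem injective_levelPerm_of_isSplittingField
    [IsSplittingField K L (iter (X ^ d - C b * X ^ m) n - C c)] :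
    Function.Injective (levelPerm (G := Gal(L/K)) (F := tri d m (algebraMap K L b))
      (c := algebraMap K L c) (tri_smul b) (fun σ => σ.commutes c) n) := by
  intro σ τ hστ
  refine AlgEquiv.coe_toAlgHom_injective (AlgHom.ext_of_adjoin_eq_top
    (IsSplittingField.adjoin_rootSet L (iter (X ^ d - C b * X ^ m) n - C c)) fun y hy => ?_)
  have hmem := aeval_iter_trinomial_sub_C_eq_zero_iff.1 (aeval_eq_zero_of_mem_rootSet hy)
  exact congrArg Subtype.val (Equiv.congr_fun hστ ⟨y, hmem⟩)

theorem isGalois_of_isSplittingField [CharZero K] (P : K[X]) [IsSplittingField K L P] :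
    IsGalois K L := by
  have := IsSplittingField.finiteDimensional L P
  have := Normal.of_isSplittingField (E := L) P
  exact {}

theorem isSplittingField_preimageField {f : K[X]} {x₀ : K} (hne : iter f n - C x₀ ≠ 0) :
    IsSplittingField K (preimageField f x₀ n) (iter f n - C x₀) := by
  have hroots : preimages f x₀ n = (iter f n - C x₀).rootSet (AlgebraicClosure K) := by
    ext α
    rw [mem_rootSet_of_ne hne, map_sub, aeval_C, sub_eq_zero]
    rfl
  rw [preimageField, hroots]
  exact IntermediateField.adjoin_rootSet_isSplittingField (IsAlgClosed.splits _)

end SplittingField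

end Arboreal

open Arboreal

theorem theorem3p1_general {K L : Type*} [Field K] [NumberField K] [Field L] [Algebra K L]
    {d m N : ℕ} (hmd : m < d) (hcop : Nat.Coprime m d) (hdm : d < 2 * m) {b x₀ : K}
    [IsSplittingField K L (iter (X ^ d - C b * X ^ m) N - C x₀)]
    (h1 : ∃ p₁ : IsDedekindDomain.HeightOneSpectrum (𝓞 K), 1 ≤ ord p₁ b ∧ ord p₁ x₀ = 1)
    (h2 : ∃ p₂ : IsDedekindDomain.HeightOneSpectrum (𝓞 K), (d : 𝓞 K) - m ∉ p₂.asIdeal ∧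
      ord p₂ b < min (ord p₂ x₀) 0 ∧ (∃ k : ℤ, ord p₂ b = k ∧ (d : ℤ) - m ∣ k) ∧
      ∃ k : ℤ, ord p₂ (x₀ / b) = k ∧ Int.gcd m k = 1)
    (h3 : ∀ n < N, ∃ p : IsDedekindDomain.HeightOneSpectrum (𝓞 K),
      0 ≤ ord p b ∧ ord p x₀ = 0 ∧ (d : 𝓞 K) ∉ p.asIdeal ∧ (d : 𝓞 K) - m ∉ p.asIdeal ∧
      ord p (iter (X ^ d - C b * X ^ m) n - C x₀).discr = 0 ∧
      ∃ k : ℤ, ord p (iter (X ^ d - C b * X ^ m) (n + 1) - C x₀).discr = k ∧ Odd k) :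
    Nonempty (Gal(L/K) ≃* wreathSym d N) := by
  classical
  have hm : 0 < m := by lia
  have : NeZero d := ⟨(hm.trans hmd).ne'⟩
  have : IsGalois K L := isGalois_of_isSplittingField (iter (X ^ d - C b * X ^ m) N - C x₀)
  have := IsSplittingField.finiteDimensional L (iter (X ^ d - C b * X ^ m) N - C x₀)
  have : NumberField L := NumberField.of_module_finite K L
  have hfiber := encard_fiber_le (d := d) hm hmd (algebraMap K L b)
  obtain ⟨p₁, hb₁, hx₁⟩ := h1
  have hcard (i) (hi : i ≤ N) :
      (level (tri d m (algebraMap K L b)) (algebraMap K L x₀) i).encard = (d ^ i : ℕ) := by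
    obtain ⟨y, hy⟩ := nonempty_level (L := L) (b := b) (c := x₀) hm hmd hi
    exact (encard_level_and_transitive_of_ord p₁ hm hmd hb₁ hx₁ hy).1
  have hfib {i} (hi : i < N) {y : L} :=
    encard_fiber_of_encard_level hfiber (hcard i hi.le) (hcard (i + 1) hi) (y := y)
  refine nonempty_mulEquiv_wreathSym (tri_smul b) (fun σ => σ.commutes x₀) hfiber hcard
    (fun n hn _ _ => ?_) injective_levelPerm_of_isSplittingField
  obtain ⟨p₂, hp₂, hb₂, hdvd, hgcd⟩ := h2
  obtain ⟨p, hb, hx, hd, hdm', hdisc, hodd⟩ := h3 n hn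
  exact swap_mem_range_levelPerm _ _ hmd hdm hcop (finite_level hfiber _ _) (fun _ => hfib hn)
    (fun _ hy => (encard_level_and_transitive_of_ord p₁ hm hmd hb₁ hx₁ hy).2)
    (exists_fiber_part_transitive_of_ord p₂ hm hmd hp₂ hb₂ hdvd hgcd
      fun i hi _ => hfib (hi.trans_lt hn))
    (exists_transposition_of_ord p hm hmd hcop hb hx hd hdm'
      (fun i hi => hcard i (hi.trans hn)) hdisc hodd)

theorem theorem3p1 {K : Type*} [Field K] [NumberField K]
    (d m : ℕ) (hm : 2 ≤ m) (hmd : m < d) (hcop : Nat.Coprime m d) (hhalf : (d : ℚ) / 2 < m)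
    (b x₀ : K) (s t u w : 𝓞 K) (ht : t ≠ 0) (hw : w ≠ 0)
    (hx₀ : x₀ = (s : K) / (t : K)) (hb : b = (u : K) / (w : K))
    (hst : IsCoprime s t) (huw : IsCoprime u w)
    (f : K[X]) (hf : f = X ^ d - C b * X ^ m)
    -- condition (1)
    (h1 : ∃ p₁ : IsDedekindDomain.HeightOneSpectrum (𝓞 K),
      1 ≤ Arboreal.ord p₁ b ∧ Arboreal.ord p₁ x₀ = 1)
    -- condition (2)
    (h2 : ∃ p₂ : IsDedekindDomain.HeightOneSpectrum (𝓞 K),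
      ((d : 𝓞 K) - (m : 𝓞 K)) ∉ p₂.asIdeal ∧
      Arboreal.ord p₂ b < min (Arboreal.ord p₂ x₀) 0 ∧
      (∃ k : ℤ, Arboreal.ord p₂ b = (k : WithTop ℤ) ∧ ((d : ℤ) - (m : ℤ)) ∣ k) ∧
      (∃ k : ℤ, Arboreal.ord p₂ (x₀ / b) = (k : WithTop ℤ) ∧ Int.gcd (m : ℤ) k = 1))
    -- condition (3)
    (h3 : ∀ n : ℕ, 1 ≤ n → ∃ p : IsDedekindDomain.HeightOneSpectrum (𝓞 K),
      s * t * u * w * (d : 𝓞 K) * ((d : 𝓞 K) - (m : 𝓞 K)) ∉ p.asIdeal ∧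
      (∃ k : ℤ, Arboreal.ord p (Arboreal.iter f n - C x₀).discr = (k : WithTop ℤ) ∧
        0 < k ∧ Odd k) ∧
      ∀ l : ℕ, l < n → Arboreal.ord p (Arboreal.iter f l - C x₀).discr = 0) :
    ∀ n : ℕ, Nonempty
      ((Arboreal.preimageField f x₀ n ≃ₐ[K] Arboreal.preimageField f x₀ n) ≃*
        Arboreal.wreathSym d n) := by
  subst hf hb hx₀
  intro N
  have hdm : d < 2 * m := by
    rw [div_lt_iff₀ two_pos, mul_comm] at hhalf
    exact_mod_cast hhalf
  have := isSplittingField_preimageField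
    (monic_iter_trinomial_sub_C (n := N) (by lia) hmd ((u : K) / w) ((s : K) / t)).ne_zero
  refine theorem3p1_general hmd hcop hdm h1 h2 fun n _ => ?_
  obtain ⟨p, hp, ⟨k, hk, -, hodd⟩, hlow⟩ := h3 (n + 1) (by lia)
  simp only [p.isPrime.mul_mem_iff_mem_or_mem, not_or] at hp
  obtain ⟨⟨⟨⟨⟨hs, ht⟩, hu⟩, hw⟩, hd⟩, hdm⟩ := hp
  exact ⟨p, (ord_div_eq_zero p hu hw).ge, ord_div_eq_zero p hs ht, hd, hdm,
    hlow n n.lt_succ_self, k, hk, hodd⟩
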